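/- Let $H$ be a finite-dimensional hereditary algebra over a field $k$, let $\mathcal D=D^b(H)$ be the bounded derived category of finitely generated $H$-modules with shift $[1]$, and regard $H$-modules as complexes concentrated in degree $0$. Let $G\colon\mathcal D\to\mathcal D$ be a triangle functor which is an autoequivalence (so that the powers $G^n$, $n\in\mathbb Z$, are defined, negative powers being those of a quasi-inverse), and assume: (g1) for each indecomposable $H$-module $U$, only finitely many of the objects $G^nU$, $n\in\mathbb Z$, are (up to isomorphism) indecomposable $H$-modules; (g2) there is $N\in\mathbb N$ such that for every indecomposable object $X$ of $\mathcal D$ some $G^iX$, $i\in\mathbb Z$, is isomorphic to $U[n]$ with $U$ an indecomposable $H$-module and $-N\le n\le N$. Let $\mathcal D/G$ be the orbit category: it has an object $\widetilde X$ for each object $X$ of $\mathcal D$, its morphisms are $$\operatorname{Hom}_{\mathcal D/G}(\widetilde X,\widetilde Y)=\coprod_{i\in\mathbb Z}\operatorname{Hom}_{\mathcal D}(G^iX,Y),$$ and the composite of $f\colon G^iX\to Y$ and $g\colon G^jY\to Z$ is $g\circ G^jf\colon G^{i+j}X\cong G^jG^iX\to Z$. (Objects in the same $G$-orbit are isomorphic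 in $\mathcal D/G$.) Then $\mathcal D/G$ is a Krull–Schmidt category, i.e. it is additive and every object is a finite direct sum of objects with local endomorphism rings. Moreover, for every indecomposable object $X$ of $\mathcal D$, the object $\widetilde X$ is indecomposable in $\mathcal D/G$ and $\operatorname{End}_{\mathcal D/G}(\widetilde X)$ is a local ring. -/

import Mathlib

open CategoryTheory CategoryTheory.Limits

namespace OrbitCat

universe w v u

section Powers

variable {C : Type u} [Category.{v} C]

/-- The natural powers `F⁰ = 𝟭`, `Fⁿ⁺¹ = F ∘ Fⁿ` of an endofunctor. -/
def natPow (F : C ⥤ C) : ℕ → C ⥤ C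
  | 0 => 𝟭 C
  | n + 1 => natPow F n ⋙ F

variable (G : C ≌ C)

/-- The integral powers `Gⁿ`, `n : ℤ`, of an autoequivalence: for negative exponents these are
the powers of the quasi-inverse of `G`. -/
def zPow : ℤ → C ⥤ C
  | Int.ofNat n => natPow G.functor n
  | Int.negSucc n => natPow G.inverse (n + 1)

/-- `G⁰` is the identity functor. -/
def zPowZero : zPow G 0 ≅ 𝟭 C := Iso.refl _

/-- The canonical isomorphism `G ∘ Gᵃ ≅ Gᵃ⁺¹`, for negative `a` through `G ∘ G⁻¹ ≅ 𝟭`. -/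
def stepIso : (a : ℤ) → (zPow G a ⋙ G.functor ≅ zPow G (a + 1))
  | Int.ofNat n => Iso.refl (natPow G.functor (n + 1))
  | Int.negSucc 0 => Functor.isoWhiskerLeft (natPow G.inverse 0) G.counitIso
  | Int.negSucc (n + 1) => Functor.isoWhiskerLeft (natPow G.inverse (n + 1)) G.counitIso

/-- `stepIso` with a free target index. -/
def stepIso' (a b : ℤ) (h : a + 1 = b) : zPow G a ⋙ G.functor ≅ zPow G b :=
  stepIso G a ≪≫ eqToIso (by rw [h])

/-- The canonical isomorphism `G⁻¹ ∘ Gᵃ⁺¹ ≅ Gᵃ`, from `stepIso` and `G⁻¹ ∘ G ≅ 𝟭`. -/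
def unstepIso' (a b : ℤ) (h : a + 1 = b) : zPow G b ⋙ G.inverse ≅ zPow G a :=
  Functor.isoWhiskerRight (stepIso' G a b h).symm G.inverse ≪≫
    Functor.associator _ _ _ ≪≫ Functor.isoWhiskerLeft (zPow G a) G.unitIso.symm ≪≫
    Functor.rightUnitor _

/-- The canonical isomorphism `Gⁿ ∘ Gⁱ ≅ Gⁱ⁺ⁿ` for `n : ℕ`, by recursion on `n`. -/
def addNat (i : ℤ) :
    (n : ℕ) → (k : ℤ) → i + n = k → (zPow G i ⋙ natPow G.functor n ≅ zPow G k)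
  | 0, k, h => Functor.rightUnitor _ ≪≫ eqToIso (by rw [← h]; simp)
  | n + 1, k, h =>
      Functor.isoWhiskerRight (addNat i n (k - 1) (by push_cast at h; lia)) G.functor ≪≫
        stepIso' G (k - 1) k (by lia)

/-- The canonical isomorphism `G⁻ⁿ ∘ Gⁱ ≅ Gⁱ⁻ⁿ` for `n : ℕ`, by recursion on `n`. -/
def subNat (i : ℤ) :
    (n : ℕ) → (k : ℤ) → i - n = k → (zPow G i ⋙ natPow G.inverse n ≅ zPow G k)
  | 0, k, h => Functor.rightUnitor _ ≪≫ eqToIso (by rw [← h]; simp)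
  | n + 1, k, h =>
      Functor.isoWhiskerRight (subNat i n (k + 1) (by push_cast at h; lia)) G.inverse ≪≫
        unstepIso' G k (k + 1) rfl

/-- The canonical isomorphism `Gʲ ∘ Gⁱ ≅ Gⁱ⁺ʲ` for `i j : ℤ`. -/
def zPowAdd (i : ℤ) : (j k : ℤ) → i + j = k → (zPow G i ⋙ zPow G j ≅ zPow G k)
  | Int.ofNat n, k, h => addNat G i n k h
  | Int.negSucc n, k, h => subNat G i (n + 1) k (by rw [Int.negSucc_eq] at h; push_cast; lia)

lemma unstepIso'_app (a b : ℤ) (h : a + 1 = b) (X : C) :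
    G.functor.map ((unstepIso' G a b h).hom.app X) ≫ (stepIso' G a b h).hom.app X =
      G.counitIso.hom.app ((zPow G b).obj X) := by
  simp [unstepIso']

lemma subNat_step (i : ℤ) (n : ℕ) (k k' : ℤ) (h : i - ((n + 1 : ℕ) : ℤ) = k) (h' : k + 1 = k')
    (h'' : i - n = k') (X : C) :
    G.counitIso.hom.app ((natPow G.inverse n).obj ((zPow G i).obj X)) ≫
        (subNat G i n k' h'').hom.app X =
      G.functor.map ((subNat G i (n + 1) k h).hom.app X) ≫ (stepIso' G k k' h').hom.app X := by
  subst h'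
  have h1 := unstepIso'_app G k (k + 1) rfl X
  have h2 := G.counitIso.hom.naturality ((subNat G i n (k + 1) h'').hom.app X)
  refine h2.symm.trans ?_
  rw [← h1, ← Category.assoc]
  exact congrArg (· ≫ _) (G.functor.map_comp _ _).symm

lemma addNat_step (i : ℤ) (n : ℕ) (k k' : ℤ) (h : i + n = k) (h' : k + 1 = k')
    (h'' : i + ((n + 1 : ℕ) : ℤ) = k') (X : C) :
    (addNat G i (n + 1) k' h'').hom.app X =
      G.functor.map ((addNat G i n k h).hom.app X) ≫ (stepIso' G k k' h').hom.app X := by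
  obtain rfl : k = k' - 1 := by lia
  rfl

/-- The isomorphisms `Gʲ ∘ Gⁱ ≅ Gⁱ⁺ʲ` are compatible with raising `j` by one. -/
lemma zPowAdd_step (i j k k' : ℤ) (h : i + j = k) (h' : k + 1 = k') (h'' : i + (j + 1) = k')
    (X : C) :
    (stepIso G j).hom.app ((zPow G i).obj X) ≫ (zPowAdd G i (j + 1) k' h'').hom.app X =
      G.functor.map ((zPowAdd G i j k h).hom.app X) ≫ (stepIso' G k k' h').hom.app X := by
  match j, h, h'' with
  | Int.ofNat n, h, h'' =>
    exact (Category.id_comp _).trans (addNat_step G i n k k' h h' (by exact_mod_cast h'') X)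
  | Int.negSucc 0, h, h'' =>
    exact subNat_step G i 0 k k' (by rw [Int.negSucc_eq] at h; push_cast at *; lia) h'
      (by rw [Int.negSucc_eq] at h; push_cast at *; lia) X
  | Int.negSucc (n + 1), h, h'' =>
    exact subNat_step G i (n + 1) k k' (by rw [Int.negSucc_eq] at h; push_cast at *; lia) h'
      (by rw [Int.negSucc_eq] at h; push_cast at *; lia) X

/-- A family of maps `Gˡ W ⟶ Gᵏ⁺ˡ X` compatible with `G` is determined by its member `l = 0`. -/
lemma family_ext (k : ℤ) (X W : C)
    (u v : ∀ l m : ℤ, k + l = m → ((zPow G l).obj W ⟶ (zPow G m).obj X))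
    (hu : ∀ l l' m m' (h : k + l = m) (h' : k + l' = m') (e : l + 1 = l') (e' : m + 1 = m'),
      (stepIso' G l l' e).hom.app W ≫ u l' m' h' =
        G.functor.map (u l m h) ≫ (stepIso' G m m' e').hom.app X)
    (hv : ∀ l l' m m' (h : k + l = m) (h' : k + l' = m') (e : l + 1 = l') (e' : m + 1 = m'),
      (stepIso' G l l' e).hom.app W ≫ v l' m' h' =
        G.functor.map (v l m h) ≫ (stepIso' G m m' e').hom.app X)
    (h0 : u 0 k (add_zero k) = v 0 k (add_zero k)) (l m : ℤ) (h : k + l = m) :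
    u l m h = v l m h := by
  induction l using Int.induction_on generalizing m with
  | zero => obtain rfl : k = m := by simpa using h
            exact h0
  | succ i ih =>
    have e' : (m - 1) + 1 = m := by lia
    have hm : k + (i : ℤ) = m - 1 := by lia
    rw [← cancel_epi ((stepIso' G i (i + 1) rfl).hom.app W), hu i (i + 1) (m - 1) m hm h rfl e',
      hv i (i + 1) (m - 1) m hm h rfl e', ih]
  | pred i ih =>
    have e : (-(i : ℤ) - 1) + 1 = -i := by lia
    have hm : k + -(i : ℤ) = m + 1 := by lia
    apply G.functor.map_injective
    rw [← cancel_mono ((stepIso' G m (m + 1) rfl).hom.app X), ← hu _ _ _ _ h hm e rfl,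
      ← hv _ _ _ _ h hm e rfl, ih]

lemma zPowAdd_step' (i j j' k k' : ℤ) (h : i + j = k) (h' : i + j' = k') (e : j + 1 = j')
    (e' : k + 1 = k') (X : C) :
    (stepIso' G j j' e).hom.app ((zPow G i).obj X) ≫ (zPowAdd G i j' k' h').hom.app X =
      G.functor.map ((zPowAdd G i j k h).hom.app X) ≫ (stepIso' G k k' e').hom.app X := by
  subst e
  rw [← zPowAdd_step G i j k k' h e' h' X]
  simp [stepIso']

lemma stepIso'_naturality (a b : ℤ) (h : a + 1 = b) {X Y : C} (f : X ⟶ Y) :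
    (stepIso' G a b h).hom.app X ≫ (zPow G b).map f =
      G.functor.map ((zPow G a).map f) ≫ (stepIso' G a b h).hom.app Y :=
  ((stepIso' G a b h).hom.naturality f).symm

lemma zPowAdd_zero_right (i : ℤ) (X : C) :
    (zPowAdd G i 0 i (add_zero i)).hom.app X = (zPowZero G).hom.app ((zPow G i).obj X) := by
  have h : (zPowAdd G i 0 i (add_zero i)).hom.app X = (addNat G i 0 i (add_zero i)).hom.app X := rfl
  rw [h]
  simp [addNat, zPowZero]
  exact Category.id_comp _

lemma zPowAdd_zero_left (j : ℤ) (X : C) :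
    (zPowAdd G 0 j j (zero_add j)).hom.app X = (zPow G j).map ((zPowZero G).hom.app X) := by
  have key := family_ext G 0 X ((zPow G 0).obj X)
    (fun l m h => (zPowAdd G 0 l m h).hom.app X)
    (fun l m h => (zPow G l).map ((zPowZero G).hom.app X) ≫ eqToHom (by rw [← h, zero_add]; rfl))
    (fun l l' m m' h h' e e' => zPowAdd_step' G 0 l l' m m' h h' e e' X)
    (fun l l' m m' h h' e e' => by
      obtain rfl : l = m := by lia
      obtain rfl : l' = m' := by lia
      have := stepIso'_naturality G l l' e ((zPowZero G).hom.app X)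
      simpa using this)
    (by
      refine (zPowAdd_zero_right G 0 X).trans ?_
      simp
      rfl)
  simpa using key j j (zero_add j)

/-- Associativity of the isomorphisms `Gʲ ∘ Gⁱ ≅ Gⁱ⁺ʲ`. -/
lemma zPowAdd_assoc (i j l ij jl m : ℤ) (hij : i + j = ij) (hjl : j + l = jl) (hm : ij + l = m)
    (hm' : i + jl = m) (X : C) :
    (zPowAdd G j l jl hjl).hom.app ((zPow G i).obj X) ≫ (zPowAdd G i jl m hm').hom.app X =
      (zPow G l).map ((zPowAdd G i j ij hij).hom.app X) ≫ (zPowAdd G ij l m hm).hom.app X := by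
  have key := family_ext G ij X ((zPow G j).obj ((zPow G i).obj X))
    (fun l m h => (zPowAdd G j l (j + l) rfl).hom.app ((zPow G i).obj X) ≫
      (zPowAdd G i (j + l) m (by lia)).hom.app X)
    (fun l m h => (zPow G l).map ((zPowAdd G i j ij hij).hom.app X) ≫
      (zPowAdd G ij l m h).hom.app X)
    (fun l l' m m' h h' e e' => by
      have h1 := zPowAdd_step' G j l l' (j + l) (j + l') rfl rfl e (by lia) ((zPow G i).obj X)
      have h2 := zPowAdd_step' G i (j + l) (j + l') m m' (by lia) (by lia) (by lia) e' X
      simp only [Functor.map_comp, Category.assoc]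
      rw [← h2, ← reassoc_of% h1])
    (fun l l' m m' h h' e e' => by
      have h1 := zPowAdd_step' G ij l l' m m' h h' e e' X
      have h2 := stepIso'_naturality G l l' e ((zPowAdd G i j ij hij).hom.app X)
      simp only [Functor.map_comp, Category.assoc]
      rw [← h1, reassoc_of% h2])
    (by
      obtain rfl := hij
      have h1 := zPowAdd_zero_right G j ((zPow G i).obj X)
      have h2 := zPowAdd_zero_right G (i + j) X
      rw [h2]
      have h3 : ∀ (q : ℤ) (hq : j = q) (h : j + 0 = q) (h' : i + q = i + j),
        (zPowAdd G j 0 q h).hom.app ((zPow G i).obj X) ≫ (zPowAdd G i q (i + j) h').hom.app X =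
          (zPowAdd G i j (i + j) rfl).hom.app X := by
        rintro q rfl h h'
        rw [h1]
        exact Category.id_comp _
      rw [h3 _ (by simp)]
      exact (Category.comp_id _).symm)
  subst hjl
  exact key l m hm

end Powers

section Orbit

variable {C : Type u} [Category.{v} C] (G : C ≌ C)

/-- The composite of morphisms `f : Gⁱ X ⟶ Y` and `g : Gʲ Y ⟶ Z` of degrees `i` and `j`:
it is `Gⁱ⁺ʲ X ≅ Gʲ Gⁱ X ⟶ Gʲ Y ⟶ Z`. -/
def degComp {X Y Z : C} (i j k : ℤ) (h : i + j = k) (f : (zPow G i).obj X ⟶ Y)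
    (g : (zPow G j).obj Y ⟶ Z) : (zPow G k).obj X ⟶ Z :=
  (zPowAdd G i j k h).inv.app X ≫ (zPow G j).map f ≫ g

lemma degComp_assoc {X Y Z W : C} (i j l ij jl m : ℤ) (hij : i + j = ij) (hjl : j + l = jl)
    (hm : ij + l = m) (hm' : i + jl = m) (f : (zPow G i).obj X ⟶ Y)
    (g : (zPow G j).obj Y ⟶ Z) (e : (zPow G l).obj Z ⟶ W) :
    degComp G ij l m hm (degComp G i j ij hij f g) e =
      degComp G i jl m hm' f (degComp G j l jl hjl g e) := by
  have h1 := zPowAdd_assoc G i j l ij jl m hij hjl hm hm' X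
  have h2 : (zPow G jl).map f ≫ (zPowAdd G j l jl hjl).inv.app Y =
      (zPowAdd G j l jl hjl).inv.app _ ≫ (zPow G l).map ((zPow G j).map f) :=
    (zPowAdd G j l jl hjl).inv.naturality f
  have h3 : (zPowAdd G ij l m hm).inv.app X ≫ (zPow G l).map ((zPowAdd G i j ij hij).inv.app X) =
      (zPowAdd G i jl m hm').inv.app X ≫ (zPowAdd G j l jl hjl).inv.app ((zPow G i).obj X) := by
    have hAB : (zPow G l).mapIso ((zPowAdd G i j ij hij).app X) ≪≫ (zPowAdd G ij l m hm).app X =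
        (zPowAdd G j l jl hjl).app ((zPow G i).obj X) ≪≫ (zPowAdd G i jl m hm').app X :=
      Iso.ext h1.symm
    exact congrArg Iso.inv hAB
  simp only [degComp, Functor.map_comp, Category.assoc]
  rw [reassoc_of% h2, reassoc_of% h3]

lemma degComp_id_left {X Y : C} (j : ℤ) (f : (zPow G j).obj X ⟶ Y) :
    degComp G 0 j j (zero_add j) ((zPowZero G).hom.app X) f = f := by
  have h := (zPowAdd G 0 j j (zero_add j)).inv_hom_id_app X
  rw [zPowAdd_zero_left] at h
  have h' := congrArg (· ≫ f) h
  simp only [Category.assoc, Category.id_comp] at h'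
  exact h'

lemma degComp_id_right {X Y : C} (i : ℤ) (f : (zPow G i).obj X ⟶ Y) :
    degComp G i 0 i (add_zero i) f ((zPowZero G).hom.app Y) = f := by
  have h : (zPow G 0).map f ≫ (zPowZero G).hom.app Y = (zPowZero G).hom.app _ ≫ f :=
    (zPowZero G).hom.naturality f
  rw [degComp, h, ← zPowAdd_zero_right]
  simp

/-- The inverse pair of morphisms of degrees `n` and `-n` between `X` and `Gⁿ X`. -/
lemma degComp_orbit (X : C) (n : ℤ) :
    degComp G n (-n) 0 (by lia) (𝟙 ((zPow G n).obj X))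
      ((zPowAdd G n (-n) 0 (by lia)).hom.app X ≫ (zPowZero G).hom.app X) =
      (zPowZero G).hom.app X := by
  rw [degComp, CategoryTheory.Functor.map_id]
  exact (congrArg _ (Category.id_comp _)).trans (Iso.inv_hom_id_app_assoc _ _ _)

lemma degComp_orbit' (X : C) (n : ℤ) :
    degComp G (-n) n 0 (by lia)
      ((zPowAdd G n (-n) 0 (by lia)).hom.app X ≫ (zPowZero G).hom.app X)
      (𝟙 ((zPow G n).obj X)) = (zPowZero G).hom.app ((zPow G n).obj X) := by
  have h := zPowAdd_assoc G n (-n) n 0 0 n (by lia) (by lia) (by lia) (by lia) X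
  rw [zPowAdd_zero_left, zPowAdd_zero_right, ← Functor.map_comp] at h
  have h1 := congrArg ((zPowAdd G (-n) n 0 (by lia)).inv.app ((zPow G n).obj X) ≫ ·) h
  refine Eq.trans ?_ (h1.symm.trans (Iso.inv_hom_id_app_assoc _ _ _))
  exact congrArg _ (Category.comp_id _)

variable [Preadditive C]

instance natPow_additive (F : C ⥤ C) [F.Additive] : (n : ℕ) → (natPow F n).Additive
  | 0 => inferInstanceAs (𝟭 C).Additive
  | n + 1 => by
      have := natPow_additive F n
      exact inferInstanceAs (natPow F n ⋙ F).Additive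

instance zPow_additive [G.functor.Additive] : (n : ℤ) → (zPow G n).Additive
  | Int.ofNat n => natPow_additive G.functor n
  | Int.negSucc n =>
      have : G.inverse.Additive := G.inverse_additive
      natPow_additive G.inverse (n + 1)

/-- The objects of the orbit category `C / G`. There is one object `X̃` for each object `X` of `C`;
objects in the same `G`-orbit become isomorphic in `C / G`, see `isoOfOrbit`. -/
structure OrbitCategory {C : Type u} [Category.{v} C] (G : C ≌ C) where
  /-- The object `X` of `C` that represents `X̃`. -/
  rep : C

/-- The morphisms `X̃ ⟶ Ỹ` of the orbit category: `⨁ i : ℤ, Hom (Gⁱ X, Y)`. -/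
abbrev OrbitHom (X Y : OrbitCategory G) : Type v :=
  DirectSum ℤ fun i => ((zPow G i).obj X.rep ⟶ Y.rep)

variable [G.functor.Additive]

/-- Composition in degrees `i`, `j` as a biadditive map into the orbit category. -/
def degCompHom (X Y Z : OrbitCategory G) (i j : ℤ) :
    ((zPow G i).obj X.rep ⟶ Y.rep) →+ ((zPow G j).obj Y.rep ⟶ Z.rep) →+ OrbitHom G X Z :=
  AddMonoidHom.mk' (fun f => AddMonoidHom.mk'
      (fun g => DirectSum.of (fun k => ((zPow G k).obj X.rep ⟶ Z.rep)) (i + j)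
        (degComp G i j (i + j) rfl f g))
      (fun g g' => by rw [← map_add]; simp [degComp]))
    (fun f f' => by
      ext g : 1
      simp [degComp, ← map_add])

/-- Composition in the orbit category, as a biadditive map. -/
def orbitComp (X Y Z : OrbitCategory G) :
    OrbitHom G X Y →+ OrbitHom G Y Z →+ OrbitHom G X Z :=
  DirectSum.toAddMonoid fun i =>
    (DirectSum.toAddMonoid fun j => (degCompHom G X Y Z i j).flip).flip

/-- A morphism `Gⁱ X ⟶ Y`, viewed as a morphism `X̃ ⟶ Ỹ` of the orbit category. -/
def ofDeg (X Y : OrbitCategory G) (i : ℤ) (f : (zPow G i).obj X.rep ⟶ Y.rep) : OrbitHom G X Y :=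
  DirectSum.of (fun i => ((zPow G i).obj X.rep ⟶ Y.rep)) i f

lemma ofDeg_comp (X Y Z : OrbitCategory G) (i j k : ℤ) (h : i + j = k)
    (f : (zPow G i).obj X.rep ⟶ Y.rep) (g : (zPow G j).obj Y.rep ⟶ Z.rep) :
    orbitComp G X Y Z (ofDeg G X Y i f) (ofDeg G Y Z j g) =
      ofDeg G X Z k (degComp G i j k h f g) := by
  subst h
  simp [orbitComp, ofDeg, degCompHom]

instance : Category.{v} (OrbitCategory G) where
  Hom X Y := OrbitHom G X Y
  id X := ofDeg G X X 0 ((zPowZero G).hom.app X.rep)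
  comp {X Y Z} f g := orbitComp G X Y Z f g
  id_comp {X Y} f := by
    induction f using DirectSum.induction_on with
    | zero => simp
    | of i f =>
      exact (ofDeg_comp G X X Y 0 i i (zero_add i) _ f).trans (by rw [degComp_id_left]; rfl)
    | add f g hf hg => rw [map_add, hf, hg]
  comp_id {X Y} f := by
    induction f using DirectSum.induction_on with
    | zero => simp
    | of i f =>
      exact (ofDeg_comp G X Y Y i 0 i (add_zero i) f _).trans (by rw [degComp_id_right]; rfl)
    | add f g hf hg => rw [map_add, AddMonoidHom.add_apply, hf, hg]
  assoc {X Y Z W} f g e := by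
    induction f using DirectSum.induction_on with
    | zero => simp
    | add f f' hf hf' => simp only [map_add, AddMonoidHom.add_apply, hf, hf']
    | of i f =>
    induction g using DirectSum.induction_on with
    | zero => simp
    | add f f' hf hf' => simp only [map_add, AddMonoidHom.add_apply, hf, hf']
    | of j g =>
    induction e using DirectSum.induction_on with
    | zero => simp
    | add f f' hf hf' => simp only [map_add, hf, hf']
    | of l e =>
      change orbitComp G X Z W (orbitComp G X Y Z (ofDeg G X Y i f) (ofDeg G Y Z j g))
          (ofDeg G Z W l e) = orbitComp G X Y W (ofDeg G X Y i f)
            (orbitComp G Y Z W (ofDeg G Y Z j g) (ofDeg G Z W l e))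
      rw [ofDeg_comp G X Y Z i j (i + j) rfl, ofDeg_comp G Y Z W j l (j + l) rfl,
        ofDeg_comp G X Z W (i + j) l (i + j + l) rfl,
        ofDeg_comp G X Y W i (j + l) (i + j + l) (by lia),
        degComp_assoc G i j l (i + j) (j + l) (i + j + l) rfl rfl rfl (by lia)]

lemma orbitComp_add_left (X Y Z : OrbitCategory G) (f f' : OrbitHom G X Y) (g : OrbitHom G Y Z) :
    orbitComp G X Y Z (f + f') g = orbitComp G X Y Z f g + orbitComp G X Y Z f' g := by
  rw [map_add, AddMonoidHom.add_apply]

lemma orbitComp_add_right (X Y Z : OrbitCategory G) (f : OrbitHom G X Y) (g g' : OrbitHom G Y Z) :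
    orbitComp G X Y Z f (g + g') = orbitComp G X Y Z f g + orbitComp G X Y Z f g' :=
  map_add (orbitComp G X Y Z f) g g'

instance : Preadditive (OrbitCategory G) where
  homGroup X Y := inferInstanceAs (AddCommGroup (OrbitHom G X Y))
  add_comp X Y Z f f' g := orbitComp_add_left G X Y Z f f' g
  comp_add X Y Z f g g' := orbitComp_add_right G X Y Z f g g'

/-- The projection functor `π : C ⥤ C / G`, the identity on representatives, which sends a
morphism of `C` to the corresponding morphism of degree `0`. -/
def proj : C ⥤ OrbitCategory G where
  obj X := ⟨X⟩
  map {X Y} f := ofDeg G ⟨X⟩ ⟨Y⟩ 0 ((zPowZero G).hom.app X ≫ f)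
  map_id X := congrArg (ofDeg G ⟨X⟩ ⟨X⟩ 0) (Category.comp_id ((zPowZero G).hom.app X))
  map_comp {X Y Z} f g := by
    refine Eq.trans ?_ (ofDeg_comp G ⟨X⟩ ⟨Y⟩ ⟨Z⟩ 0 0 0 rfl ((zPowZero G).hom.app X ≫ f)
      ((zPowZero G).hom.app Y ≫ g)).symm
    congr 1
    have h := degComp_id_left G 0 ((zPowZero G).hom.app X ≫ f ≫ g)
    rw [degComp] at h ⊢
    have h' := (zPowZero G).hom.naturality f
    rw [Functor.map_comp, Category.assoc]
    refine h.symm.trans ?_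
    congr 2
    exact ((reassoc_of% h') g).symm

instance : (proj G).Additive where
  map_add {X Y f g} := by
    refine (congrArg (ofDeg G ⟨X⟩ ⟨Y⟩ 0) (Preadditive.comp_add _ _ _ _ f g)).trans ?_
    exact map_add (DirectSum.of (fun i => ((zPow G i).obj X ⟶ Y)) 0) _ _

instance [HasFiniteBiproducts C] : HasFiniteBiproducts (OrbitCategory G) where
  out _ :=
    { has_biproduct := fun F =>
        ⟨⟨{ bicone := (proj G).mapBicone (biproduct.bicone fun i => (F i).rep)
            isBilimit := isBilimitOfPreserves (proj G) (biproduct.isBilimit _) }⟩⟩ }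

instance [HasFiniteBiproducts C] : HasBinaryBiproducts (OrbitCategory G) :=
  hasBinaryBiproducts_of_finite_biproducts _

/-- Objects of `C` in the same `G`-orbit become isomorphic in `C / G`. -/
def isoOfOrbit (X : C) (n : ℤ) : (proj G).obj X ≅ (proj G).obj ((zPow G n).obj X) where
  hom := ofDeg G ⟨X⟩ ⟨(zPow G n).obj X⟩ n (𝟙 ((zPow G n).obj X))
  inv := ofDeg G ⟨(zPow G n).obj X⟩ ⟨X⟩ (-n)
    ((zPowAdd G n (-n) 0 (by lia)).hom.app X ≫ (zPowZero G).hom.app X)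
  hom_inv_id := (ofDeg_comp G ⟨X⟩ ⟨(zPow G n).obj X⟩ ⟨X⟩ n (-n) 0 (by lia) _ _).trans
    (congrArg (ofDeg G ⟨X⟩ ⟨X⟩ 0) (degComp_orbit G X n))
  inv_hom_id := (ofDeg_comp G ⟨(zPow G n).obj X⟩ ⟨X⟩ ⟨(zPow G n).obj X⟩ (-n) n 0
    (by lia) _ _).trans
    (congrArg (ofDeg G ⟨(zPow G n).obj X⟩ ⟨(zPow G n).obj X⟩ 0) (degComp_orbit' G X n))

end Orbit

section KrullSchmidt

/-- A Krull-Schmidt category: an additive category in which every object is a finite direct sum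
of objects with local endomorphism rings. -/
structure IsKrullSchmidt (A : Type u) [Category.{v} A] [Preadditive A] : Prop where
  hasFiniteBiproducts : HasFiniteBiproducts A
  exists_decomposition (X : A) : ∃ (n : ℕ) (Y : Fin n → A) (b : Bicone Y),
    Nonempty b.IsBilimit ∧ Nonempty (X ≅ b.pt) ∧ ∀ i, IsLocalRing (End (Y i))

end KrullSchmidt

section Derived

/-- A ring is (left) hereditary if all its left ideals are projective modules. -/
def IsHereditaryRing (H : Type u) [Ring H] : Prop :=
  ∀ I : Ideal H, Module.Projective H I

variable (H : Type u) [Ring H] [IsNoetherianRing H] [HasDerivedCategory.{w} (FGModuleCat.{u} H)]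

/-- The bounded derived category `Dᵇ(H)` of finitely generated `H`-modules. -/
abbrev Db : Type (u + 1) := DerivedCategory.Bounded (FGModuleCat.{u} H)

variable {H}

/-- The embedding of finitely generated `H`-modules into `Dᵇ(H)` as complexes in degree `0`. -/
noncomputable def stalk : FGModuleCat.{u} H ⥤ Db.{w} H :=
  (DerivedCategory.TStructure.t (C := FGModuleCat.{u} H)).bounded.lift
    (DerivedCategory.singleFunctor (FGModuleCat.{u} H) 0)
    (fun _ => ⟨⟨0, inferInstance⟩, ⟨0, inferInstance⟩⟩)

/-- Condition (g1): for each indecomposable `H`-module `U`, up to isomorphism only finitely many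
objects `Gⁿ U`, `n : ℤ`, are indecomposable `H`-modules. -/
def ConditionG1 (G : Db.{w} H ≌ Db.{w} H) : Prop :=
  ∀ U : FGModuleCat.{u} H, Indecomposable U →
    ∃ S : Set (FGModuleCat.{u} H), S.Finite ∧
      ∀ (n : ℤ) (V : FGModuleCat.{u} H), Indecomposable V →
        Nonempty ((zPow G n).obj (stalk.obj U) ≅ stalk.obj V) → ∃ W ∈ S, Nonempty (V ≅ W)

/-- Condition (g2): for some `N`, each `G`-orbit of indecomposable objects of `Dᵇ(H)` has a
representative of the form `U[n]`, with `U` an indecomposable `H`-module and `-N ≤ n ≤ N`. -/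
def ConditionG2 (G : Db.{w} H ≌ Db.{w} H) : Prop :=
  ∃ N : ℕ, ∀ X : Db.{w} H, Indecomposable X →
    ∃ (i : ℤ) (U : FGModuleCat.{u} H) (n : ℤ), Indecomposable U ∧ n ∈ Set.Icc (-(N : ℤ)) N ∧
      Nonempty ((zPow G i).obj X ≅ (stalk.obj U)⟦n⟧)

end Derived

end OrbitCat

universe w u t

open OrbitCat

/-!
For `H` hereditary every finitely generated module has projective dimension at most one, so
`Ext^d` vanishes for `d ≥ 2`, the truncation triangles of bounded complexes split, and every object
of `Dᵇ(H)` is a finite direct sum of objects `U[n]` with `U` an indecomposable module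
(`sumClosure_isShiftedIndecomposable`). By Fitting's lemma, and since `End_H(U)` is
finite-dimensional, the endomorphism ring of `U[n]` is local with nilpotent maximal ideal
(`IsShiftedIndecomposable.hasNilpotentLocalEnd`).

Let `X` be indecomposable in `Dᵇ(H)`. If `Gⁱ X ≅ X` for some `i ≠ 0`, then up to isomorphism the
orbit of `X` is finite, so it lives in boundedly many degrees; a large shift `X[M]` then violates
(g2) (`not_nonempty_zPow_iso`). So `G` acts freely on the isomorphism classes of indecomposable
objects, and (g1) becomes a statement about exponents: for each `m`, only finitely many `Gⁱ X` are
modules shifted by `m`. As there are no non-zero morphisms `U[a] ⟶ V[b]` unless `b - a` is `0` or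
`1`, only finitely many of the groups `Hom (Gⁱ X, X)` are non-zero (`finite_setOf_hom_ne_zero`).

Hence the endomorphism ring of `X` in the orbit category is a `ℤ`-graded ring with finitely many
non-zero components. Its degree zero part is `End X`, which is local with nilpotent maximal ideal
`N`. A product of elements of degrees `i` and `-i`, `i ≠ 0`, lies in `N`: if it were
invertible, `X` would be a retract of the indecomposable object `Gⁱ X`, hence isomorphic to it.
In such a ring `N` together with the components of non-zero degree spans a nilpotent ideal: among
the partial degrees of a long non-zero product of homogeneous elements some value is repeated
often, and the blocks between the repetitions belong to `N`, which is nilpotent. Therefore the ring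
is local (`isLocalRing_of_grading`, `isLocalRing_end_proj`). The direct sum decompositions in
`Dᵇ(H)` are preserved by the projection to the orbit category, which gives the Krull-Schmidt
property.
-/

namespace OrbitCat

open Pointwise

/-! ### Local graded rings -/

section GradedRing

variable {R : Type*} [Ring R] (A : ℤ → AddSubgroup R) (N : Set R)

/-- The homogeneous elements that belong to the candidate maximal ideal of a `ℤ`-graded ring: the
elements of `N`, which plays the role of the maximal ideal of the degree zero part, and all
elements of non-zero degree. -/
def homogeneousRadical : Set R := {x | x ∈ N ∨ ∃ i ≠ 0, x ∈ A i}

/-- The product `f a * f (a + 1) * ⋯ * f (b - 1)` of a block of a sequence. -/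
def blockProd (f : ℕ → R) (a b : ℕ) : R := ((List.range' a (b - a)).map f).prod

lemma blockProd_self (f : ℕ → R) (a : ℕ) : blockProd f a a = 1 := by simp [blockProd]

lemma blockProd_mul (f : ℕ → R) {a b c : ℕ} (hab : a ≤ b) (hbc : b ≤ c) :
    blockProd f a b * blockProd f b c = blockProd f a c := by
  obtain ⟨m, rfl⟩ := Nat.exists_eq_add_of_le hab
  obtain ⟨n, rfl⟩ := Nat.exists_eq_add_of_le hbc
  have h : a + m + n - a = m + n := by lia
  simp only [blockProd, h, Nat.add_sub_cancel_left, ← List.prod_append, ← List.map_append]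
  rw [List.range'_append_1]

lemma blockProd_succ_right (f : ℕ → R) {a b : ℕ} (hab : a ≤ b) :
    blockProd f a (b + 1) = blockProd f a b * f b := by
  rw [← blockProd_mul f hab (Nat.le_succ b)]
  simp [blockProd]

variable {A N}

section

variable (hone : 1 ∈ A 0) (hmul : ∀ i j x y, x ∈ A i → y ∈ A j → x * y ∈ A (i + j))
  (hN : N ⊆ A 0) (hNmul : ∀ x ∈ N, ∀ y ∈ A 0, y * x ∈ N)
  (hoff : ∀ i ≠ 0, ∀ x ∈ A i, ∀ y ∈ A (-i), x * y ∈ N)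

include hone hmul in
lemma blockProd_mem_degree {f : ℕ → R} {e : ℕ → ℤ} (hf : ∀ n, f n ∈ A (e n)) {a b : ℕ}
    (hab : a ≤ b) :
    blockProd f a b ∈ A (∑ i ∈ Finset.range b, e i - ∑ i ∈ Finset.range a, e i) := by
  induction b, hab using Nat.le_induction with
  | base => simpa [blockProd_self] using hone
  | succ b hab ih =>
    rw [blockProd_succ_right f hab, Finset.sum_range_succ, add_sub_right_comm]
    exact hmul _ _ _ _ ih (hf b)

include hone hmul hNmul hoff in
/-- A non-empty block of total degree zero lies in `N`. -/
lemma blockProd_mem_of_sum_eq {f : ℕ → R} {e : ℕ → ℤ} (hf : ∀ n, f n ∈ A (e n))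
    (hfN : ∀ n, e n = 0 → f n ∈ N) {a b : ℕ} (hab : a < b)
    (h : ∑ i ∈ Finset.range a, e i = ∑ i ∈ Finset.range b, e i) : blockProd f a b ∈ N := by
  obtain ⟨b, rfl⟩ : ∃ c, b = c + 1 := ⟨b - 1, by lia⟩
  have hab' : a ≤ b := Nat.lt_succ_iff.1 hab
  rw [blockProd_succ_right f hab']
  have h1 := blockProd_mem_degree hone hmul hf hab'
  rw [h, Finset.sum_range_succ, sub_add_cancel_left] at h1
  by_cases h0 : e b = 0
  · rw [h0, neg_zero] at h1
    exact hNmul _ (hfN b h0) _ h1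
  · exact hoff _ (neg_ne_zero.2 h0) _ h1 _ (by simpa using hf b)

include hone hmul hN hNmul hoff in
/-- If only finitely many degrees occur and `N` is nilpotent, then long products of homogeneous
elements of the radical vanish: the partial degrees of a non-zero product take few values, so one
of them is repeated often, and the blocks between the repetitions lie in `N`. -/
lemma exists_homogeneousRadical_pow_subset (hfin : {i | A i ≠ ⊥}.Finite) {L : ℕ}
    (hNL : N ^ L ⊆ {0}) : ∃ n, homogeneousRadical A N ^ n ⊆ {0} := by
  classical
  refine ⟨hfin.toFinset.card * L, fun x hx => ?_⟩
  set n := hfin.toFinset.card * L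
  obtain ⟨g, rfl⟩ := Set.mem_pow.1 hx
  by_contra hne
  have hdeg : ∀ x ∈ homogeneousRadical A N, ∃ i, x ∈ A i ∧ (i = 0 → x ∈ N) := by
    rintro x (hx | ⟨i, hi, hx⟩)
    · exact ⟨0, hN hx, fun _ => hx⟩
    · exact ⟨i, hx, fun h => absurd h hi⟩
  by_cases hn : n = 0
  -- an empty product: either no degree occurs, or `L = 0`, and in both cases the ring is zero
  · rcases Nat.mul_eq_zero.1 hn with h | h
    · have h0 : A 0 = ⊥ := by
        by_contra h0
        rw [Finset.card_eq_zero] at h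
        have : (0 : ℤ) ∈ hfin.toFinset := by simpa using h0
        simp [h] at this
      rw [h0, AddSubgroup.mem_bot] at hone
      exact hne (eq_zero_of_zero_eq_one hone.symm _)
    · have h1 : (1 : R) = 0 := by simpa [h] using hNL
      exact hne (eq_zero_of_zero_eq_one h1.symm _)
  -- periodic extension of the `n` factors to a sequence
  let f : ℕ → R := fun i => g ⟨i % n, Nat.mod_lt _ (Nat.pos_of_ne_zero hn)⟩
  have hfg : (List.ofFn fun i => (g i : R)).prod = blockProd f 0 n := by
    congr 1
    refine List.ext_getElem (by simp) fun i hi _ => ?_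
    have hi' : i < n := by simpa using hi
    simp [f, Nat.mod_eq_of_lt hi']
  choose! e he using hdeg
  have hfe : ∀ i, f i ∈ A (e (f i)) := fun i => (he _ (g _).2).1
  have hfN : ∀ i, e (f i) = 0 → f i ∈ N := fun i => (he _ (g _).2).2
  let s : ℕ → ℤ := fun m => ∑ i ∈ Finset.range m, e (f i)
  have hs : ∀ m ∈ Finset.range (n + 1), s m ∈ hfin.toFinset := by
    intro m hm
    have hm' : m ≤ n := Nat.lt_succ_iff.1 (Finset.mem_range.1 hm)
    have h1 := blockProd_mem_degree hone hmul hfe (Nat.zero_le m)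
    rw [Finset.sum_range_zero, sub_zero] at h1
    simp only [Set.Finite.mem_toFinset, Set.mem_ofPred_eq]
    intro h0
    change blockProd f 0 m ∈ A (s m) at h1
    rw [h0, AddSubgroup.mem_bot] at h1
    refine hne ?_
    rw [hfg, ← blockProd_mul f (Nat.zero_le m) hm', h1]
    simp
  -- more than `L` of the `n + 1` partial degrees coincide
  obtain ⟨y, -, hy⟩ := Finset.exists_lt_card_fiber_of_mul_lt_card_of_maps_to (n := L) hs
    (by simp [n])
  obtain ⟨F, hF, hFcard⟩ := Finset.exists_subset_card_eq (Nat.succ_le_of_lt hy)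
  let j := F.orderEmbOfFin hFcard
  have hj : ∀ c, j c ≤ n ∧ s (j c) = y := fun c => by
    have := hF (F.orderEmbOfFin_mem hFcard c)
    simp only [Finset.mem_filter, Finset.mem_range] at this
    exact ⟨Nat.lt_succ_iff.1 this.1, this.2⟩
  have hblock : ∀ c (hc : c < L + 1), blockProd f (j 0) (j ⟨c, hc⟩) ∈ N ^ c := by
    intro c
    induction c with
    | zero => intro hc; simp [blockProd_self]
    | succ c ih =>
      intro hc
      have h1 : j 0 ≤ j ⟨c, by lia⟩ := j.monotone (Fin.zero_le _)
      have h2 : j ⟨c, by lia⟩ < j ⟨c + 1, hc⟩ := j.strictMono (by simp)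
      rw [← blockProd_mul f h1 h2.le, pow_succ]
      exact Set.mul_mem_mul (ih (by lia))
        (blockProd_mem_of_sum_eq hone hmul hNmul hoff hfe hfN h2 ((hj _).2.trans (hj _).2.symm))
  have h0 : blockProd f (j 0) (j (Fin.last L)) = 0 := hNL (hblock L (by lia))
  refine hne ?_
  rw [hfg, ← blockProd_mul f (Nat.zero_le (j 0)) (hj 0).1,
    ← blockProd_mul f (j.monotone (Fin.zero_le (Fin.last L))) (hj _).1, h0]
  simp

include hone hmul hN hNmul hoff in
/-- A `ℤ`-graded ring with finitely many non-zero components is local if the non-units of degree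
zero form a nilpotent set `N`, and products of homogeneous elements of degrees `i` and `-i` with
`i ≠ 0` are never invertible, in the sense that they lie in `N`. -/
theorem isLocalRing_of_grading [Nontrivial R] (hspan : ⨆ i, A i = ⊤)
    (hfin : {i | A i ≠ ⊥}.Finite) {L : ℕ} (hNL : N ^ L ⊆ {0})
    (hunit : ∀ x ∈ A 0, x ∈ N ∨ ∃ y ∈ A 0, x * y = 1 ∧ y * x = 1) : IsLocalRing R := by
  obtain ⟨n, hn⟩ := exists_homogeneousRadical_pow_subset hone hmul hN hNmul hoff hfin hNL
  let J : Submodule ℤ R := Submodule.span ℤ (homogeneousRadical A N)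
  have hnil : ∀ x ∈ J, IsNilpotent x := fun x hx => by
    refine ⟨n, ?_⟩
    have h1 : x ^ n ∈ J ^ n := Submodule.pow_mem_pow _ hx n
    rw [Submodule.span_pow] at h1
    simpa using Submodule.span_mono hn h1
  have hJ : ∀ i ≠ 0, ∀ x ∈ A i, x ∈ J := fun i hi x hx =>
    Submodule.subset_span (Or.inr ⟨i, hi, hx⟩)
  have hdec : ∀ x : R, ∃ x₀ ∈ A 0, ∃ y ∈ ⨆ i : {i : ℤ // i ≠ 0}, A i, x = x₀ + y := fun x => by
    have hx : x ∈ A 0 ⊔ ⨆ i : {i : ℤ // i ≠ 0}, A i := by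
      have hle : ⨆ i, A i ≤ A 0 ⊔ ⨆ i : {i : ℤ // i ≠ 0}, A i := iSup_le fun i => by
        by_cases hi : i = 0
        · subst hi; exact le_sup_left
        · exact (le_iSup (fun i : {i : ℤ // i ≠ 0} => A i) ⟨i, hi⟩).trans le_sup_right
      exact hle (hspan ▸ AddSubgroup.mem_top x)
    obtain ⟨x₀, h0, y, hy, rfl⟩ := AddSubgroup.mem_sup.1 hx
    exact ⟨x₀, h0, y, hy, rfl⟩
  have hmem : ∀ z ∈ A 0, ∀ y ∈ ⨆ i : {i : ℤ // i ≠ 0}, A i, z * y ∈ J := fun z hz y hy => by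
    induction hy using AddSubgroup.iSup_induction' with
    | hp i x hx => exact hJ i i.2 _ (by simpa using hmul 0 i z x hz hx)
    | h1 => simp
    | hadd x y _ _ hx hy => rw [mul_add]; exact J.add_mem hx hy
  refine IsLocalRing.of_isUnit_or_isUnit_one_sub_self fun x => ?_
  obtain ⟨x₀, h0, y, hy, rfl⟩ := hdec x
  rcases hunit x₀ h0 with hN0 | ⟨z, hz, hxz, hzx⟩
  · right
    have h1 : x₀ + y ∈ J := J.add_mem (Submodule.subset_span (Or.inl hN0)) (by
      simpa using hmem 1 hone y hy)
    exact (hnil _ h1).isUnit_one_sub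
  · left
    have h1 : x₀ + y = x₀ * (1 + z * y) := by rw [mul_add, ← mul_assoc, hxz]; simp
    rw [h1]
    exact IsUnit.mul ⟨⟨x₀, z, hxz, hzx⟩, rfl⟩ (hnil _ (hmem z hz y hy)).isUnit_one_add

end

end GradedRing

/-! ### Rings whose elements are invertible or nilpotent -/

section FittingRing

variable {E : Type*} [Ring E]

lemma isLocalRing_of_isUnit_or_isNilpotent [Nontrivial E]
    (h : ∀ x : E, IsUnit x ∨ IsNilpotent x) : IsLocalRing E :=
  IsLocalRing.of_isUnit_or_isUnit_one_sub_self fun x =>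
    (h x).imp_right fun hx => hx.isUnit_one_sub

/-- A left multiple of a nilpotent element `x` is never invertible: otherwise `z * x = 1` for some
`z`, hence `1 = z ^ n * x ^ n = 0`. -/
lemma not_isUnit_mul_of_isNilpotent [Nontrivial E] {x : E} (hx : IsNilpotent x) (y : E) :
    ¬ IsUnit (y * x) := by
  obtain ⟨n, hn⟩ := hx
  intro hu
  obtain ⟨z, hz⟩ : ∃ z, z * x = 1 := by
    obtain ⟨u, hu⟩ := hu
    exact ⟨↑u⁻¹ * y, by rw [mul_assoc, ← hu, Units.inv_mul]⟩
  have h1 : ∀ m : ℕ, z ^ m * x ^ m = 1 := by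
    intro m
    induction m with
    | zero => simp
    | succ m ih => rw [pow_succ, pow_succ', mul_assoc, ← mul_assoc z, hz, one_mul, ih]
  have := h1 n
  rw [hn, mul_zero] at this
  exact zero_ne_one this

/-- In an Artinian ring all of whose elements are invertible or nilpotent, the non-units lie in the
Jacobson radical, hence form a nilpotent set. -/
lemma exists_nonunits_pow_subset [Nontrivial E] [IsArtinianRing E]
    (h : ∀ x : E, IsUnit x ∨ IsNilpotent x) : ∃ L : ℕ, (nonunits E) ^ L ⊆ {0} := by
  obtain ⟨L, hL⟩ := IsSemiprimaryRing.isNilpotent (R := E)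
  refine ⟨L, fun x hx => ?_⟩
  have hJ : ∀ x ∈ nonunits E, x ∈ Ring.jacobson E := by
    intro x hx
    have hx' : IsNilpotent x := (h x).resolve_left hx
    rw [← Ideal.jacobson_bot, Ideal.mem_jacobson_iff]
    intro y
    have h1 : IsNilpotent (y * x) := (h _).resolve_left (not_isUnit_mul_of_isNilpotent hx' y)
    obtain ⟨u, hu⟩ := h1.isUnit_one_add
    refine ⟨↑u⁻¹, ?_⟩
    have h2 : (↑u⁻¹ : E) * (1 + y * x) = 1 := by rw [← hu, Units.inv_mul]
    rw [Ideal.mem_bot, mul_assoc, ← h2]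
    noncomm_ring
  have h2 : ∀ n : ℕ, ∀ x ∈ (nonunits E) ^ n, x ∈ (Ring.jacobson E) ^ n := by
    intro n
    induction n with
    | zero => intro x _; rw [Submodule.pow_zero, Ideal.one_eq_top]; trivial
    | succ n ih =>
      intro x hx
      rw [pow_succ'] at hx
      rw [Ideal.IsTwoSided.pow_succ]
      obtain ⟨a, ha, b, hb, rfl⟩ := hx
      exact Ideal.mul_mem_mul (hJ a ha) (ih b hb)
  have h3 := h2 L x hx
  rw [hL] at h3
  simpa using h3

end FittingRing

/-! ### Indecomposable objects and idempotents -/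

section Indecomposable

variable {A : Type*} [Category A] [Preadditive A]

lemma indecomposable_of_iso [HasBinaryBiproducts A] {X Y : A} (e : X ≅ Y)
    (h : Indecomposable X) : Indecomposable Y :=
  ⟨fun hY => h.1 (hY.of_iso e), fun Z W a => h.2 Z W (e ≪≫ a)⟩

lemma not_isZero_of_isLocalRing_end {X : A} [IsLocalRing (End X)] : ¬ IsZero X := fun h =>
  one_ne_zero (α := End X) (h.eq_of_src _ _)

lemma idempotent_eq_zero_or_one {E : Type*} [Ring E] [IsLocalRing E] {e : E} (he : e * e = e) :
    e = 0 ∨ e = 1 := by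
  rcases IsLocalRing.isUnit_or_isUnit_of_add_one (add_sub_cancel e 1) with h | h
  · right
    exact h.mul_left_cancel (by rw [he, mul_one])
  · left
    exact h.mul_left_cancel (by rw [sub_mul, one_mul, he, sub_self, mul_zero])

lemma indecomposable_of_isLocalRing_end [HasBinaryBiproducts A] {X : A} [IsLocalRing (End X)] :
    Indecomposable X := by
  refine ⟨not_isZero_of_isLocalRing_end, fun Y Z a => ?_⟩
  let e : End X := a.hom ≫ biprod.fst ≫ biprod.inl ≫ a.inv
  have he : e * e = e := by simp [e, End.mul_def]
  rcases idempotent_eq_zero_or_one he with h | h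
  · left
    rw [IsZero.iff_id_eq_zero]
    have h1 : (biprod.inl ≫ a.inv) ≫ e ≫ a.hom ≫ biprod.fst = 𝟙 Y := by simp [e]
    rw [← h1, h]
    exact (congrArg _ zero_comp).trans comp_zero
  · right
    rw [IsZero.iff_id_eq_zero]
    have h1 : (biprod.inr ≫ a.inv) ≫ e ≫ a.hom ≫ biprod.snd = 0 := by simp [e]
    rw [← h1, h]
    refine Eq.trans ?_ (congrArg ((biprod.inr ≫ a.inv) ≫ ·) (Category.id_comp _).symm)
    simp

/-- A non-zero retract of an object with local endomorphism ring is isomorphic to it. -/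
lemma nonempty_iso_of_retract {X Y : A} [IsLocalRing (End Y)] (hX : ¬ IsZero X) (s : X ⟶ Y)
    (r : Y ⟶ X) (h : s ≫ r = 𝟙 X) : Nonempty (X ≅ Y) := by
  let e : End Y := r ≫ s
  have he : e * e = e := by simp [e, End.mul_def, reassoc_of% h]
  rcases idempotent_eq_zero_or_one he with h0 | h1
  · refine absurd ?_ hX
    rw [IsZero.iff_id_eq_zero]
    have h2 : s ≫ e ≫ r = 𝟙 X := by simp [e, h]
    rw [← h2, h0]
    exact (congrArg _ zero_comp).trans comp_zero
  · exact ⟨⟨s, r, h, h1⟩⟩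

lemma nonempty_iso_biprod_of_isZero_left [HasBinaryBiproducts A] {X Y : A} (h : IsZero X) :
    Nonempty (X ⊞ Y ≅ Y) :=
  ⟨⟨biprod.snd, biprod.inr, by
    ext
    · exact h.eq_of_src _ _
    · exact h.eq_of_src _ _
    · exact h.eq_of_tgt _ _
    · simp, by simp⟩⟩

lemma nonempty_iso_biprod_of_isZero_right [HasBinaryBiproducts A] {X Y : A} (h : IsZero Y) :
    Nonempty (X ⊞ Y ≅ X) :=
  ⟨⟨biprod.fst, biprod.inl, by
    ext
    · simp
    · exact h.eq_of_tgt _ _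
    · exact h.eq_of_src _ _
    · exact h.eq_of_src _ _, by simp⟩⟩

/-- In an idempotent complete additive category an indecomposable object has only the trivial
idempotent endomorphisms. -/
lemma Indecomposable.idempotent_eq_zero_or_one [HasBinaryBiproducts A] [IsIdempotentComplete A]
    {X : A} (hX : Indecomposable X) (e : X ⟶ X) (he : e ≫ e = e) : e = 0 ∨ e = 𝟙 X := by
  obtain ⟨Y, i, p, hip, hpi⟩ := IsIdempotentComplete.idempotents_split X e he
  obtain ⟨Z, j, q, hjq, hqj⟩ := IsIdempotentComplete.idempotents_split X (𝟙 X - e) (by simp [he])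
  have hiq : i ≫ q = 0 := by
    have h1 : i ≫ (p ≫ i) ≫ (q ≫ j) ≫ q = 0 := by
      rw [hpi, hqj]
      simp [reassoc_of% he]
    simpa [reassoc_of% hip, hjq] using h1
  have hjp : j ≫ p = 0 := by
    have h1 : j ≫ (q ≫ j) ≫ (p ≫ i) ≫ p = 0 := by
      rw [hpi, hqj]
      simp [reassoc_of% he]
    simpa [reassoc_of% hjq, hip] using h1
  have a : X ≅ Y ⊞ Z :=
    { hom := biprod.lift p q
      inv := biprod.desc i j
      hom_inv_id := by rw [biprod.lift_desc, hpi, hqj]; abel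
      inv_hom_id := by ext <;> simp [hip, hjq, hiq, hjp] }
  rcases hX.2 Y Z a with h | h
  · left
    rw [← hpi, h.eq_of_tgt p 0, zero_comp]
  · right
    rw [h.eq_of_tgt q 0, zero_comp] at hqj
    exact (sub_eq_zero.1 hqj.symm).symm

end Indecomposable

/-! ### Finite direct sums -/

section SumClosure

variable {A : Type*} [Category A] [Preadditive A] [HasBinaryBiproducts A]

/-- The closure of a class `P` of objects under isomorphisms and finite direct sums. -/
inductive SumClosure (P : A → Prop) : A → Prop
  | zero (X : A) (h : IsZero X) : SumClosure P X
  | of (X : A) (h : P X) : SumClosure P X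
  | biprod (X Y : A) (hX : SumClosure P X) (hY : SumClosure P Y) : SumClosure P (X ⊞ Y)
  | iso (X Y : A) (e : X ≅ Y) (hX : SumClosure P X) : SumClosure P Y

lemma SumClosure.exists_iso_of_indecomposable {P : A → Prop} {X : A} (h : SumClosure P X)
    (hX : Indecomposable X) : ∃ Y, P Y ∧ Nonempty (X ≅ Y) := by
  induction h with
  | zero X h => exact absurd h hX.1
  | of X h => exact ⟨X, h, ⟨Iso.refl X⟩⟩
  | biprod X Y _ _ ihX ihY =>
    rcases hX.2 X Y (Iso.refl _) with h | h
    · obtain ⟨e⟩ := nonempty_iso_biprod_of_isZero_left (Y := Y) h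
      obtain ⟨Z, hZ, ⟨e'⟩⟩ := ihY (indecomposable_of_iso e hX)
      exact ⟨Z, hZ, ⟨e ≪≫ e'⟩⟩
    · obtain ⟨e⟩ := nonempty_iso_biprod_of_isZero_right (X := X) h
      obtain ⟨Z, hZ, ⟨e'⟩⟩ := ihX (indecomposable_of_iso e hX)
      exact ⟨Z, hZ, ⟨e ≪≫ e'⟩⟩
  | iso X Y e _ ih =>
    obtain ⟨Z, hZ, ⟨e'⟩⟩ := ih (indecomposable_of_iso e.symm hX)
    exact ⟨Z, hZ, ⟨e.symm ≪≫ e'⟩⟩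

lemma SumClosure.bind {P Q : A → Prop} (hPQ : ∀ X, P X → SumClosure Q X) {X : A}
    (h : SumClosure P X) : SumClosure Q X := by
  induction h with
  | zero X h => exact .zero X h
  | of X h => exact hPQ X h
  | biprod X Y _ _ ihX ihY => exact .biprod X Y ihX ihY
  | iso X Y e _ ih => exact .iso X Y e ih

lemma SumClosure.exists_bicone {P : A → Prop} {X : A} (h : SumClosure P X) :
    ∃ (J : Type) (_ : Fintype J) (Y : J → A) (b : Bicone Y),
      Nonempty b.IsBilimit ∧ Nonempty (X ≅ b.pt) ∧ ∀ i, P (Y i) := by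
  classical
  induction h with
  | zero X h =>
    exact ⟨Empty, inferInstance, Empty.elim, ⟨X, Empty.rec, Empty.rec, fun i => i.elim⟩,
      ⟨isBilimitOfTotal _ (h.eq_of_src _ _)⟩, ⟨Iso.refl X⟩, fun i => i.elim⟩
  | of X h =>
    refine ⟨Unit, inferInstance, fun _ => X, ⟨X, fun _ => 𝟙 X, fun _ => 𝟙 X, fun _ _ => ?_⟩,
      ⟨isBilimitOfTotal _ ?_⟩, ⟨Iso.refl X⟩, fun _ => h⟩ <;> simp
  | biprod X X' _ _ ih ih' =>
    obtain ⟨J, _, Y, b, ⟨hb⟩, ⟨e⟩, hY⟩ := ih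
    obtain ⟨J', _, Y', b', ⟨hb'⟩, ⟨e'⟩, hY'⟩ := ih'
    let c : Bicone (Sum.elim Y Y') :=
      { pt := X ⊞ X'
        π := fun i => match i with
          | .inl i => biprod.fst ≫ e.hom ≫ b.π i
          | .inr i => biprod.snd ≫ e'.hom ≫ b'.π i
        ι := fun i => match i with
          | .inl i => b.ι i ≫ e.inv ≫ biprod.inl
          | .inr i => b'.ι i ≫ e'.inv ≫ biprod.inr
        ι_π := fun i j => by
          rcases i with i | i <;> rcases j with j | j
          · by_cases h : i = j
            · subst h; simp; rfl
            · simp [h, b.ι_π]; rfl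
          · simp; rfl
          · simp; rfl
          · by_cases h : i = j
            · subst h; simp; rfl
            · simp [h, b'.ι_π]; rfl }
    refine ⟨J ⊕ J', inferInstance, _, c, ⟨isBilimitOfTotal c ?_⟩, ⟨Iso.refl _⟩, ?_⟩
    · have h1 := IsBilimit.total hb
      have h2 := IsBilimit.total hb'
      have h3 : ∑ j, c.π (.inl j) ≫ c.ι (.inl j) = (biprod.fst ≫ biprod.inl : X ⊞ X' ⟶ _) := by
        have : ∀ j, c.π (.inl j) ≫ c.ι (.inl j) =
            (biprod.fst ≫ e.hom) ≫ (b.π j ≫ b.ι j) ≫ e.inv ≫ biprod.inl := by simp [c]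
        simp_rw [this]
        rw [← Preadditive.comp_sum, ← Preadditive.sum_comp, h1]
        simp
      have h4 : ∑ j, c.π (.inr j) ≫ c.ι (.inr j) = (biprod.snd ≫ biprod.inr : X ⊞ X' ⟶ _) := by
        have : ∀ j, c.π (.inr j) ≫ c.ι (.inr j) =
            (biprod.snd ≫ e'.hom) ≫ (b'.π j ≫ b'.ι j) ≫ e'.inv ≫ biprod.inr := by simp [c]
        simp_rw [this]
        rw [← Preadditive.comp_sum, ← Preadditive.sum_comp, h2]
        simp
      rw [Fintype.sum_sum_type]
      exact (congrArg₂ (· + ·) h3 h4).trans biprod.total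
    · rintro (i | i)
      exacts [hY i, hY' i]
  | iso X X' e _ ih =>
    obtain ⟨J, _, Y, b, hb, ⟨e'⟩, hY⟩ := ih
    exact ⟨J, inferInstance, Y, b, hb, ⟨e.symm ≪≫ e'⟩, hY⟩

lemma SumClosure.exists_fin_bicone {P : A → Prop} {X : A} (h : SumClosure P X) :
    ∃ (n : ℕ) (Y : Fin n → A) (b : Bicone Y),
      Nonempty b.IsBilimit ∧ Nonempty (X ≅ b.pt) ∧ ∀ i, P (Y i) := by
  obtain ⟨J, _, Y, b, ⟨hb⟩, e, hY⟩ := h.exists_bicone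
  let g := (Fintype.equivFin J).symm
  exact ⟨_, _, b.whisker g, ⟨(b.whiskerIsBilimitIff g).symm hb⟩, e, fun i => hY (g i)⟩

variable {B : Type*} [Category B] [Preadditive B] [HasBinaryBiproducts B]

lemma nonempty_mapBiprod_iso (F : A ⥤ B) [F.Additive] (X Y : A) :
    Nonempty (F.obj (X ⊞ Y) ≅ F.obj X ⊞ F.obj Y) :=
  have := preservesBinaryBiproducts_of_preservesBiproducts F
  ⟨F.mapBiprod X Y⟩

lemma SumClosure.map (F : A ⥤ B) [F.Additive] {P : A → Prop} {Q : B → Prop}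
    (hF : ∀ X, P X → Q (F.obj X)) {X : A} (h : SumClosure P X) : SumClosure Q (F.obj X) := by
  induction h with
  | zero X h => exact .zero _ (F.map_isZero h)
  | of X h => exact .of _ (hF X h)
  | biprod X Y _ _ ihX ihY =>
    obtain ⟨e⟩ := nonempty_mapBiprod_iso F X Y
    exact .iso _ _ e.symm (.biprod _ _ ihX ihY)
  | iso X Y e _ ih => exact .iso _ _ (F.mapIso e) ih

/-- For fully faithful `F`, a decomposition of `F X` into summands that come from the source of `F`
lifts to a decomposition of `X`. -/
lemma SumClosure.of_map [HasZeroObject A] (F : A ⥤ B) [F.Additive] [F.Full] [F.Faithful]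
    {P : A → Prop} {Q : B → Prop} (hF : ∀ Y, Q Y → ∃ X, P X ∧ Nonempty (F.obj X ≅ Y)) {X : A}
    (h : SumClosure Q (F.obj X)) : SumClosure P X := by
  have key : ∀ Z, SumClosure Q Z → ∃ X, SumClosure P X ∧ Nonempty (F.obj X ≅ Z) := by
    intro Z hZ
    induction hZ with
    | zero Z h =>
      obtain ⟨O, hO⟩ := HasZeroObject.zero (C := A)
      exact ⟨O, .zero O hO, ⟨(F.map_isZero hO).iso h⟩⟩
    | of Z h =>
      obtain ⟨X, hX, e⟩ := hF Z h
      exact ⟨X, .of X hX, e⟩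
    | biprod Z Z' _ _ ih ih' =>
      obtain ⟨X, hX, ⟨e⟩⟩ := ih
      obtain ⟨X', hX', ⟨e'⟩⟩ := ih'
      obtain ⟨a⟩ := nonempty_mapBiprod_iso F X X'
      exact ⟨X ⊞ X', .biprod X X' hX hX', ⟨a ≪≫ biprod.mapIso e e'⟩⟩
    | iso Z Z' a _ ih =>
      obtain ⟨X, hX, ⟨e⟩⟩ := ih
      exact ⟨X, hX, ⟨e ≪≫ a⟩⟩
  obtain ⟨X', hX', ⟨e⟩⟩ := key _ h
  exact .iso _ _ (F.preimageIso e) hX'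

end SumClosure

/-! ### Local endomorphism rings with nilpotent maximal ideal -/

section LocalEnd

variable {A : Type*} [Category A] [Preadditive A]

/-- An object whose endomorphism ring is local with nilpotent maximal ideal: for some `L` all
products of `L` non-invertible endomorphisms vanish. -/
structure HasNilpotentLocalEnd (X : A) : Prop where
  isLocalRing : IsLocalRing (End X)
  exists_pow : ∃ L : ℕ, (nonunits (End X)) ^ L ⊆ {0}

lemma isLocalRing_and_nilpotent_of_ringEquiv {R S : Type*} [Ring R] [Ring S] (e : R ≃+* S)
    (h : IsLocalRing R ∧ ∃ L : ℕ, (nonunits R) ^ L ⊆ {0}) :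
    IsLocalRing S ∧ ∃ L : ℕ, (nonunits S) ^ L ⊆ {0} := by
  obtain ⟨h1, L, hL⟩ := h
  have : Nontrivial S := e.injective.nontrivial
  refine ⟨.of_is_unit_or_is_unit_of_add_one fun {a b} hab => ?_, L, ?_⟩
  · have h1 : e.symm a + e.symm b = 1 := by rw [← map_add, hab, map_one]
    exact (IsLocalRing.isUnit_or_isUnit_of_add_one h1).imp
      (fun h => (isUnit_map_iff e.symm a).1 h) (fun h => (isUnit_map_iff e.symm b).1 h)
  have h2 : e '' nonunits R = nonunits S := by
    ext x
    constructor
    · rintro ⟨y, hy, rfl⟩ hx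
      exact hy ((isUnit_map_iff e y).1 hx)
    · intro hx
      refine ⟨e.symm x, fun h => hx ?_, e.apply_symm_apply x⟩
      simpa using h.map e
  rw [← h2, ← Set.image_pow]
  rintro _ ⟨x, hx, rfl⟩
  have : x = 0 := hL hx
  simp [this]

lemma HasNilpotentLocalEnd.of_iso {X Y : A} (e : X ≅ Y) (h : HasNilpotentLocalEnd X) :
    HasNilpotentLocalEnd Y := by
  let a : End X ≃+* End Y := { e.conj with
    map_add' := fun f g =>
      (congrArg (e.inv ≫ ·) (Preadditive.add_comp _ _ _ f g e.hom)).trans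
        (Preadditive.comp_add _ _ _ _ _ _) }
  obtain ⟨h1, h2⟩ := isLocalRing_and_nilpotent_of_ringEquiv a ⟨h.1, h.2⟩
  exact ⟨h1, h2⟩

lemma HasNilpotentLocalEnd.map {B : Type*} [Category B] [Preadditive B] (F : A ⥤ B) [F.Additive]
    [F.Full] [F.Faithful] {X : A} (h : HasNilpotentLocalEnd X) :
    HasNilpotentLocalEnd (F.obj X) := by
  let a : End X ≃+* End (F.obj X) := { (Functor.FullyFaithful.ofFullyFaithful F).mulEquivEnd X with
    map_add' := fun f g => F.map_add }
  obtain ⟨h1, h2⟩ := isLocalRing_and_nilpotent_of_ringEquiv a ⟨h.1, h.2⟩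
  exact ⟨h1, h2⟩

end LocalEnd

/-! ### Modules over hereditary rings -/

section Hereditary

variable {H : Type u} [Ring H]

/-- Over a hereditary ring, submodules of finitely generated free modules are projective. -/
lemma projective_of_injective_to_pi (hH : IsHereditaryRing H) (n : ℕ) (M : Type*)
    [AddCommGroup M] [Module H M] (f : M →ₗ[H] (Fin n → H)) (hf : Function.Injective f) :
    Module.Projective H M := by
  induction n generalizing M with
  | zero =>
    have : Subsingleton M := hf.subsingleton
    infer_instance
  | succ n ih =>
    let φ : M →ₗ[H] H := (LinearMap.proj 0).comp f
    have hI : Module.Projective H φ.range := hH φ.range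
    obtain ⟨s, hs⟩ := Module.projective_lifting_property φ.rangeRestrict LinearMap.id
      φ.surjective_rangeRestrict
    have hs' : ∀ y, φ (s y) = y := fun y => congrArg Subtype.val (LinearMap.congr_fun hs y)
    have hK : Module.Projective H φ.ker :=
      ih φ.ker (((LinearMap.funLeft H H Fin.succ).comp f).comp φ.ker.subtype) (by
        rw [injective_iff_map_eq_zero]
        intro x hx
        apply Subtype.ext
        apply hf
        funext i
        refine Fin.cases ?_ (fun i => ?_) i
        · exact (LinearMap.mem_ker.1 x.2).trans (congrFun (map_zero f) 0).symm
        · simpa using congrFun hx i)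
    let i : M →ₗ[H] φ.ker × φ.range :=
      (LinearMap.codRestrict φ.ker (LinearMap.id - s.comp φ.rangeRestrict) (fun x => by
        simp [LinearMap.mem_ker, hs'])).prod φ.rangeRestrict
    let r : φ.ker × φ.range →ₗ[H] M := φ.ker.subtype.coprod s
    exact Module.Projective.of_split i r (by ext x; simp [i, r])

variable [IsNoetherianRing H]

lemma projective_fgModuleCat (P : FGModuleCat.{u} H) [Module.Projective H P] : Projective P := by
  have : Projective ((forget₂ (FGModuleCat.{u} H) (ModuleCat.{u} H)).obj P) :=
    P.obj.projective_of_categoryTheory_projective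
  exact (forget₂ (FGModuleCat.{u} H) (ModuleCat.{u} H)).projective_of_map_projective this

lemma fgModuleCat_injective_of_mono {X Y : FGModuleCat.{u} H} (f : X ⟶ Y) [Mono f] :
    Function.Injective f.hom.hom := by
  have : Mono ((forget₂ (FGModuleCat.{u} H) (ModuleCat.{u} H)).map f) := inferInstance
  exact (ModuleCat.mono_iff_injective _).1 this

/-- Finitely generated modules over a hereditary ring have projective dimension at most one. -/
lemma hasProjectiveDimensionLT_two (hH : IsHereditaryRing H) (U : FGModuleCat.{u} H) :
    HasProjectiveDimensionLT U 2 := by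
  obtain ⟨n, f, hf⟩ := Module.Finite.exists_fin' H U
  let F : FGModuleCat.{u} H := FGModuleCat.of H (Fin n → H)
  let p : F ⟶ U := FGModuleCat.ofHom f
  have : Epi p := by
    have : Epi ((forget₂ (FGModuleCat.{u} H) (ModuleCat.{u} H)).map p) :=
      (ModuleCat.epi_iff_surjective _).2 hf
    exact (forget₂ (FGModuleCat.{u} H) (ModuleCat.{u} H)).epi_of_epi_map this
  have : Module.Projective H F := inferInstanceAs (Module.Projective H (Fin n → H))
  have hF : Projective F := projective_fgModuleCat F
  have : Module.Projective H (kernel p : FGModuleCat.{u} H) :=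
    projective_of_injective_to_pi hH n _ (kernel.ι p).hom.hom (fgModuleCat_injective_of_mono _)
  have hK : Projective (kernel p) := projective_fgModuleCat _
  have hS : (ShortComplex.mk (kernel.ι p) p (kernel.condition p)).ShortExact :=
    { exact := ShortComplex.exact_kernel p }
  exact hS.hasProjectiveDimensionLT_X₃ 1 inferInstance inferInstance

end Hereditary

/-! ### Indecomposable modules of finite length -/

section FiniteLength

variable {H : Type u} [Ring H]

/-- Endomorphism rings of finitely generated modules over a finite-dimensional algebra are
finite-dimensional, hence Artinian. -/
lemma isArtinianRing_moduleEnd (k : Type t) [Field k] [Algebra k H] [FiniteDimensional k H]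
    (M : Type*) [AddCommGroup M] [Module H M] [Module.Finite H M] :
    IsArtinianRing (Module.End H M) := by
  let _ : Module k M := Module.compHom M (algebraMap k H)
  have : IsScalarTower k H M := IsScalarTower.of_algebraMap_smul fun _ _ => rfl
  have : Module.Finite k M := Module.Finite.trans H M
  have : Module.Finite k (Module.End H M) :=
    Module.Finite.of_injective (LinearMap.restrictScalarsₗ k H M M k)
      (LinearMap.restrictScalars_injective k)
  exact IsArtinianRing.of_finite k _

variable [IsNoetherianRing H]

/-- Fitting's lemma for an indecomposable module of finite length. -/
lemma isUnit_or_isNilpotent_of_indecomposable [IsArtinianRing H] {U : FGModuleCat.{u} H}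
    (hU : Indecomposable U) (f : Module.End H U) : IsUnit f ∨ IsNilpotent f := by
  obtain ⟨n, hn⟩ := (f.eventually_isCompl_ker_pow_range_pow.and
    (Filter.eventually_ge_atTop 1)).exists
  obtain ⟨hc, hn1⟩ := hn
  -- the idempotent with image `ker (f ^ n)` and kernel `range (f ^ n)`
  let e : Module.End H U := Submodule.projection _ _ hc
  have he : e ∘ₗ e = e := Submodule.isIdempotentElem_projection hc
  let e' : U ⟶ U := FGModuleCat.ofHom e
  have he' : e' ≫ e' = e' := by
    apply FGModuleCat.hom_ext
    exact he
  rcases Indecomposable.idempotent_eq_zero_or_one hU e' he' with h | h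
  · left
    have h1 : e = 0 := congrArg (fun g : U ⟶ U => g.hom.hom) h
    have h2 : (f ^ n).ker = ⊥ := by
      rw [← Submodule.range_projection hc]
      exact LinearMap.range_eq_bot.2 h1
    have h3 : (f ^ n).range = ⊤ := by
      have := hc.sup_eq_top
      rwa [h2, bot_sup_eq] at this
    have h4 : IsUnit (f ^ n) := by
      rw [Module.End.isUnit_iff]
      exact ⟨LinearMap.ker_eq_bot.1 h2, LinearMap.range_eq_top.1 h3⟩
    exact (isUnit_pow_iff (by lia)).1 h4
  · right
    refine ⟨n, ?_⟩
    have h1 : e = LinearMap.id := congrArg (fun g : U ⟶ U => g.hom.hom) h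
    rw [← LinearMap.ker_eq_top, ← Submodule.range_projection hc]
    change e.range = ⊤
    rw [h1, LinearMap.range_id]

lemma hasNilpotentLocalEnd_of_indecomposable (k : Type t) [Field k] [Algebra k H]
    [FiniteDimensional k H] {U : FGModuleCat.{u} H} (hU : Indecomposable U) :
    HasNilpotentLocalEnd U := by
  have : IsArtinianRing H := IsArtinianRing.of_finite k H
  have : IsArtinianRing (Module.End H U) := isArtinianRing_moduleEnd k U
  let a : End U ≃+* Module.End H U :=
    { toFun := fun f => f.hom.hom
      invFun := fun f => FGModuleCat.ofHom f
      left_inv := fun _ => rfl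
      right_inv := fun _ => rfl
      map_mul' := fun _ _ => rfl
      map_add' := fun _ _ => rfl }
  have h0 : Nontrivial (End U) := ⟨1, 0, fun h => hU.1 ((IsZero.iff_id_eq_zero U).2 h)⟩
  have : Nontrivial (Module.End H U) := a.injective.nontrivial
  have hf := isUnit_or_isNilpotent_of_indecomposable hU
  obtain ⟨h1, h2⟩ := isLocalRing_and_nilpotent_of_ringEquiv a.symm
    ⟨isLocalRing_of_isUnit_or_isNilpotent hf, exists_nonunits_pow_subset hf⟩
  exact ⟨h1, h2⟩

/-- A proper direct summand has smaller length. -/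
lemma length_lt_of_iso_biprod [IsArtinianRing H] {U Y Z : FGModuleCat.{u} H} (a : U ≅ Y ⊞ Z)
    (hZ : ¬ IsZero Z) : Module.length H Y < Module.length H U := by
  let i : Y ⟶ U := biprod.inl ≫ a.inv
  let q : U ⟶ Z := a.hom ≫ biprod.snd
  have hi : Function.Injective i.hom.hom := fgModuleCat_injective_of_mono i
  have hiq : i ≫ q = 0 := by simp [i, q]
  have hne : i.hom.hom.range ≠ ⊤ := by
    intro h
    apply hZ
    have hq : q = 0 := by
      apply FGModuleCat.hom_ext
      ext x
      obtain ⟨y, rfl⟩ := LinearMap.range_eq_top.1 h x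
      exact congrArg (fun g : Y ⟶ Z => g.hom.hom y) hiq
    rw [IsZero.iff_id_eq_zero]
    have h1 : (biprod.inr ≫ a.inv) ≫ q = 𝟙 Z := by simp [q]
    rw [← h1, hq, comp_zero]
  have h1 : Module.length H Y = Module.length H i.hom.hom.range :=
    (LinearEquiv.ofInjective i.hom.hom hi).length_eq
  rw [h1]
  exact Submodule.length_lt hne

/-- Modules of finite length are finite direct sums of indecomposable modules, by induction on the
length. -/
lemma sumClosure_indecomposable [IsArtinianRing H] (U : FGModuleCat.{u} H) :
    SumClosure Indecomposable U := by
  induction h : Module.length H U using WellFoundedLT.induction generalizing U with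
  | ind n ih =>
    subst h
    by_cases h0 : IsZero U
    · exact .zero U h0
    by_cases hU : Indecomposable U
    · exact .of U hU
    obtain ⟨Y, Z, a, hY, hZ⟩ : ∃ (Y Z : FGModuleCat.{u} H) (_ : U ≅ Y ⊞ Z),
        ¬ IsZero Y ∧ ¬ IsZero Z := by
      by_contra! hcon
      refine hU ⟨h0, fun Y Z a => ?_⟩
      by_contra! hYZ
      exact hYZ.2 (hcon Y Z a hYZ.1)
    exact .iso _ _ a.symm (.biprod Y Z (ih _ (length_lt_of_iso_biprod a hZ) Y rfl)
      (ih _ (length_lt_of_iso_biprod (a ≪≫ biprod.braiding Y Z) hY) Z rfl))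

end FiniteLength

/-! ### Derived categories in global dimension one -/

section HereditaryDerived

open Pretriangulated DerivedCategory

variable {C : Type*} [Category C] [Abelian C] [HasDerivedCategory.{w} C]

lemma singleFunctor_hom_eq_zero_of_lt {X Y : C} {n m : ℤ} (h : n < m)
    (f : (singleFunctor C n).obj X ⟶ (singleFunctor C m).obj Y) : f = 0 :=
  TStructure.t.zero f n m h

/-- If `C` has global dimension at most one, then `Ext^d` vanishes for `d ≥ 2`. -/
lemma singleFunctor_hom_eq_zero_of_add_two_le (hC : ∀ X : C, HasProjectiveDimensionLT X 2)
    {X Y : C} {n m : ℤ} (h : m + 2 ≤ n)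
    (f : (singleFunctor C n).obj X ⟶ (singleFunctor C m).obj Y) : f = 0 := by
  have : HasExt.{_} C := HasExt.standard C
  have := hC X
  obtain ⟨d, hd⟩ := Int.eq_ofNat_of_zero_le (show 0 ≤ n - m by lia)
  have hzero : ∀ g : (singleFunctor C 0).obj X ⟶ ((singleFunctor C 0).obj Y)⟦(d : ℤ)⟧,
      g = 0 := fun g => by
    obtain ⟨e, rfl⟩ := (Abelian.Ext.homEquiv (X := X) (Y := Y) (n := d)).surjective g
    rw [Abelian.Ext.eq_zero_of_hasProjectiveDimensionLT e 2 (by lia)]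
    exact Abelian.Ext.zero_hom _ _ _
  let a := ((singleFunctors C).shiftIso n 0 n (by lia)).app X
  let b := ((singleFunctors C).shiftIso n (m - n) m (by lia)).app Y ≪≫
    (((singleFunctors C).shiftIso (d : ℤ) (m - n) 0 (by lia)).app Y).symm
  have h1 := hzero (a.inv ≫ f⟦n⟧' ≫ b.hom)
  rw [← cancel_epi a.hom, ← cancel_mono b.inv] at h1
  apply (shiftFunctor (DerivedCategory C) n).map_injective
  simpa using h1

/-- A complex in degrees `[a, c]` is an extension of its top cohomology by a complex in degrees
`[a, c - 1]`. -/
lemma exists_triangle_singleFunctor (Z : DerivedCategory C) {a c : ℤ} (hac : a ≤ c)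
    (ha : Z.IsGE a) (hc : Z.IsLE c) :
    ∃ (A : DerivedCategory C) (V : C) (f : A ⟶ Z) (g : Z ⟶ (singleFunctor C c).obj V)
      (h : (singleFunctor C c).obj V ⟶ A⟦(1 : ℤ)⟧),
      A.IsGE a ∧ A.IsLE (c - 1) ∧ Triangle.mk f g h ∈ distTriang _ := by
  obtain ⟨A, B, hA, hB, f, g, h, hT⟩ := TStructure.t.exists_triangle Z (c - 1) c (by lia)
  have hA' : A.IsLE (c - 1) := ⟨hA⟩
  have hB' : B.IsGE c := ⟨hB⟩
  have hA1 : (A⟦(1 : ℤ)⟧).IsLE (c - 2) := TStructure.t.isLE_shift A (c - 1) 1 (c - 2)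
  have hBle : B.IsLE c := TStructure.t.isLE₂ _ (rot_of_distTriang _ hT) c hc
    (TStructure.t.isLE_of_le (A⟦(1 : ℤ)⟧) (c - 2) c)
  have hB1 : (B⟦(-1 : ℤ)⟧).IsGE (c + 1) := TStructure.t.isGE_shift B c (-1) (c + 1)
  have hAge : A.IsGE a := TStructure.t.isGE₂ _ (inv_rot_of_distTriang _ hT) a
    (TStructure.t.isGE_of_ge (B⟦(-1 : ℤ)⟧) a (c + 1)) ha
  obtain ⟨V, ⟨e⟩⟩ := exists_iso_singleFunctor_obj_of_isGE_of_isLE B c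
  refine ⟨A, V, f, g ≫ e.hom, e.inv ≫ h, hAge, hA', ?_⟩
  exact isomorphic_distinguished _ hT _
    (Triangle.isoMk _ _ (Iso.refl _) (Iso.refl _) e.symm
      ((Category.comp_id f).trans (Category.id_comp f).symm)
      (((Category.assoc g _ _).trans ((g ≫= e.hom_inv_id).trans (Category.comp_id g))).trans
        (Category.id_comp g).symm)
      ((congrArg ((e.inv ≫ h) ≫ ·) (CategoryTheory.Functor.map_id _ A)).trans
        (Category.comp_id _)))

/-- There are no non-zero morphisms from an object in degree `n` to a bounded complex in degrees
`≤ n - 2`, by dévissage of the target along its truncations. -/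
lemma hom_eq_zero_of_isLE (hC : ∀ X : C, HasProjectiveDimensionLT X 2) {a c n : ℤ}
    (Z : DerivedCategory C) (ha : Z.IsGE a) (hc : Z.IsLE c) (hn : c + 2 ≤ n) {X : C}
    (f : (singleFunctor C n).obj X ⟶ Z) : f = 0 := by
  obtain ⟨d, hd⟩ : ∃ d : ℕ, c - a < d := ⟨(c - a + 1).toNat, by lia⟩
  induction d generalizing Z c with
  | zero => exact (TStructure.t.isZero Z c a (by lia)).eq_of_tgt _ _
  | succ d ih =>
    by_cases hac : a ≤ c
    · obtain ⟨A, V, p, q, r, hA, hA', hT⟩ := exists_triangle_singleFunctor Z hac ha hc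
      obtain ⟨g, hg⟩ := Triangle.coyoneda_exact₂ _ hT f
        (singleFunctor_hom_eq_zero_of_add_two_le hC hn _)
      have hg0 : g = 0 := ih A hA hA' (by lia) g (by lia)
      rw [hg, hg0]
      exact zero_comp
    · exact (TStructure.t.isZero Z c a (by lia)).eq_of_tgt _ _

/-- Over an abelian category of global dimension at most one, every bounded complex is the direct
sum of its shifted cohomology objects: the connecting morphism out of the top cohomology
vanishes. -/
lemma sumClosure_singleFunctor (hC : ∀ X : C, HasProjectiveDimensionLT X 2) {a c : ℤ}
    (Z : DerivedCategory C) (ha : Z.IsGE a) (hc : Z.IsLE c) :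
    SumClosure (fun Z => ∃ (n : ℤ) (V : C), Z = (singleFunctor C n).obj V) Z := by
  obtain ⟨d, hd⟩ : ∃ d : ℕ, c - a < d := ⟨(c - a + 1).toNat, by lia⟩
  induction d generalizing Z c with
  | zero => exact .zero Z (TStructure.t.isZero Z c a (by lia))
  | succ d ih =>
    by_cases hac : a ≤ c
    · obtain ⟨A, V, p, q, r, hA, hA', hT⟩ := exists_triangle_singleFunctor Z hac ha hc
      have hr : r = 0 := hom_eq_zero_of_isLE hC (A⟦(1 : ℤ)⟧)
        (TStructure.t.isGE_shift A a 1 (a - 1)) (TStructure.t.isLE_shift A (c - 1) 1 (c - 2))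
        (by lia) r
      obtain ⟨e, -⟩ := exists_iso_binaryBiproduct_of_distTriang _ hT hr
      exact .iso _ _ e.symm (.biprod _ _ (ih A hA hA' (by lia)) (.of _ ⟨c, V, rfl⟩))
    · exact .zero Z (TStructure.t.isZero Z c a (by lia))

end HereditaryDerived

/-! ### The bounded derived category of a hereditary algebra -/

section Stalk

open DerivedCategory

variable {H : Type u} [Ring H] [IsNoetherianRing H] [HasDerivedCategory.{w} (FGModuleCat.{u} H)]

/-- `U[n]` is `U` placed in cohomological degree `-n`. -/
lemma nonempty_iso_singleFunctor (U : FGModuleCat.{u} H) (n : ℤ) :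
    Nonempty (Bounded.ι.obj ((stalk.obj U : Db.{w} H)⟦n⟧) ≅
      (singleFunctor (FGModuleCat.{u} H) (-n)).obj U) :=
  ⟨(Functor.commShiftIso (Bounded.ι : Db.{w} H ⥤ _) n).app (stalk.obj U) ≪≫
    ((singleFunctors (FGModuleCat.{u} H)).shiftIso n (-n) 0 (by lia)).app U⟩

/-- The embedding `stalk` composed with the inclusion of `Dᵇ(H)` into the unbounded derived
category. -/
noncomputable def stalkCompι :
    (stalk : FGModuleCat.{u} H ⥤ Db.{w} H) ⋙ Bounded.ι ≅ singleFunctor (FGModuleCat.{u} H) 0 :=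
  Iso.refl _

instance stalk_full : (stalk : FGModuleCat.{u} H ⥤ Db.{w} H).Full :=
  Functor.Full.of_comp_faithful_iso
    stalkCompι

instance stalk_faithful : (stalk : FGModuleCat.{u} H ⥤ Db.{w} H).Faithful :=
  Functor.Faithful.of_comp_iso stalkCompι

instance stalk_additive : (stalk : FGModuleCat.{u} H ⥤ Db.{w} H).Additive where
  map_add {_ _ f g} := Bounded.ι.map_injective (by
    refine Eq.trans ?_ (Functor.map_add _).symm
    exact (singleFunctor (FGModuleCat.{u} H) 0).map_add)

/-- Morphisms `U[a] ⟶ V[b]` in `Dᵇ(H)`, for `H` hereditary, vanish unless `b - a` is `0` or `1`. -/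
lemma stalk_hom_eq_zero (hH : IsHereditaryRing H) {U V : FGModuleCat.{u} H} {a b : ℤ}
    (h : b < a ∨ a + 2 ≤ b) (f : (stalk.obj U : Db.{w} H)⟦a⟧ ⟶ (stalk.obj V)⟦b⟧) : f = 0 := by
  obtain ⟨e⟩ := nonempty_iso_singleFunctor.{w} U a
  obtain ⟨e'⟩ := nonempty_iso_singleFunctor.{w} V b
  have h1 : e.inv ≫ Bounded.ι.map f ≫ e'.hom = 0 := by
    rcases h with h | h
    · exact singleFunctor_hom_eq_zero_of_lt (by lia) _
    · exact singleFunctor_hom_eq_zero_of_add_two_le (hasProjectiveDimensionLT_two hH) (by lia) _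
  rw [← cancel_epi e.hom, ← cancel_mono e'.inv] at h1
  apply Bounded.ι.map_injective
  simpa using h1

/-- The objects `U[n]` of `Dᵇ(H)` with `U` an indecomposable `H`-module. -/
def IsShiftedIndecomposable (X : Db.{w} H) : Prop :=
  ∃ (U : FGModuleCat.{u} H) (n : ℤ), Indecomposable U ∧ Nonempty (X ≅ (stalk.obj U)⟦n⟧)

lemma IsShiftedIndecomposable.shift {X : Db.{w} H} (hX : IsShiftedIndecomposable X) (m : ℤ) :
    IsShiftedIndecomposable (X⟦m⟧) := by
  obtain ⟨U, n, hU, ⟨e⟩⟩ := hX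
  exact ⟨U, n + m, hU, ⟨(shiftFunctor _ m).mapIso e ≪≫ ((shiftFunctorAdd _ n m).app _).symm⟩⟩

/-- For `H` hereditary, every object of `Dᵇ(H)` is a finite direct sum of shifted indecomposable
modules. -/
lemma sumClosure_isShiftedIndecomposable [IsArtinianRing H] (hH : IsHereditaryRing H)
    (X : Db.{w} H) : SumClosure IsShiftedIndecomposable X := by
  obtain ⟨⟨a, ha⟩, ⟨c, hc⟩⟩ := X.property
  have h1 := sumClosure_singleFunctor (hasProjectiveDimensionLT_two hH) X.obj ha hc
  refine SumClosure.of_map Bounded.ι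
    (Q := fun Z => ∃ X : Db.{w} H, IsShiftedIndecomposable X ∧ Nonempty (Bounded.ι.obj X ≅ Z))
    (fun Y hY => hY) (h1.bind ?_)
  rintro _ ⟨n, V, rfl⟩
  refine (sumClosure_indecomposable V).map (singleFunctor (FGModuleCat.{u} H) n) fun U hU => ?_
  obtain ⟨e⟩ := nonempty_iso_singleFunctor.{w} U (-n)
  rw [neg_neg] at e
  exact ⟨_, ⟨U, -n, hU, ⟨Iso.refl _⟩⟩, ⟨e⟩⟩

lemma IsShiftedIndecomposable.of_indecomposable [IsArtinianRing H] (hH : IsHereditaryRing H)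
    {X : Db.{w} H} (hX : Indecomposable X) : IsShiftedIndecomposable X := by
  obtain ⟨Y, ⟨U, n, hU, ⟨e'⟩⟩, ⟨e⟩⟩ :=
    (sumClosure_isShiftedIndecomposable hH X).exists_iso_of_indecomposable hX
  exact ⟨U, n, hU, ⟨e ≪≫ e'⟩⟩

lemma IsShiftedIndecomposable.hasNilpotentLocalEnd (k : Type t) [Field k] [Algebra k H]
    [FiniteDimensional k H] {X : Db.{w} H} (hX : IsShiftedIndecomposable X) :
    HasNilpotentLocalEnd X := by
  obtain ⟨U, n, hU, ⟨e⟩⟩ := hX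
  exact .of_iso e.symm (((hasNilpotentLocalEnd_of_indecomposable k hU).map stalk).map
    (shiftFunctor (Db.{w} H) n))

lemma IsShiftedIndecomposable.indecomposable (k : Type t) [Field k] [Algebra k H]
    [FiniteDimensional k H] {X : Db.{w} H} (hX : IsShiftedIndecomposable X) :
    Indecomposable X :=
  have := (hX.hasNilpotentLocalEnd k).isLocalRing
  indecomposable_of_isLocalRing_end

end Stalk

/-! ### Powers of an autoequivalence -/

section ZPow

variable {C : Type*} [Category C] (G : C ≌ C)

instance natPow_isEquivalence (F : C ⥤ C) [F.IsEquivalence] :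
    (n : ℕ) → (natPow F n).IsEquivalence
  | 0 => inferInstanceAs (𝟭 C).IsEquivalence
  | n + 1 => by
      have := natPow_isEquivalence F n
      exact inferInstanceAs (natPow F n ⋙ F).IsEquivalence

instance zPow_isEquivalence : (n : ℤ) → (zPow G n).IsEquivalence
  | Int.ofNat n => natPow_isEquivalence G.functor n
  | Int.negSucc n => natPow_isEquivalence G.inverse (n + 1)

variable {G}

lemma nonempty_zPow_sub_iso {i j : ℤ} {X : C} (e : (zPow G i).obj X ≅ (zPow G j).obj X) :
    Nonempty ((zPow G (i - j)).obj X ≅ X) :=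
  ⟨((zPowAdd G i (-j) (i - j) (by lia)).app X).symm ≪≫ (zPow G (-j)).mapIso e ≪≫
    (zPowAdd G j (-j) 0 (by lia)).app X ≪≫ (zPowZero G).app X⟩

lemma nonempty_zPow_mul_iso {i : ℤ} {X : C} (e : (zPow G i).obj X ≅ X) (q : ℤ) :
    Nonempty ((zPow G (i * q)).obj X ≅ X) := by
  induction q using Int.induction_on with
  | zero => rw [mul_zero]; exact ⟨(zPowZero G).app X⟩
  | succ q ih =>
    obtain ⟨e'⟩ := ih
    exact ⟨((zPowAdd G i (i * q) _ (by ring)).app X).symm ≪≫ (zPow G _).mapIso e ≪≫ e'⟩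
  | pred q ih =>
    obtain ⟨e'⟩ := ih
    have h : i * (-(q : ℤ)) - i = i * (-(q : ℤ) - 1) := by ring
    rw [← h]
    exact nonempty_zPow_sub_iso (e' ≪≫ e.symm)

section Shift

variable [HasShift C ℤ]

lemma nonempty_natPow_shift_iso {F : C ⥤ C}
    (hF : ∀ (X : C) (n : ℤ), Nonempty (F.obj (X⟦n⟧) ≅ (F.obj X)⟦n⟧)) (m : ℕ) (X : C) (n : ℤ) :
    Nonempty ((natPow F m).obj (X⟦n⟧) ≅ ((natPow F m).obj X)⟦n⟧) := by
  induction m with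
  | zero => exact ⟨Iso.refl _⟩
  | succ m ih =>
    obtain ⟨e⟩ := ih
    obtain ⟨e'⟩ := hF ((natPow F m).obj X) n
    exact ⟨F.mapIso e ≪≫ e'⟩

lemma nonempty_zPow_shift_iso [G.functor.CommShift ℤ] (i : ℤ) (X : C) (n : ℤ) :
    Nonempty ((zPow G i).obj (X⟦n⟧) ≅ ((zPow G i).obj X)⟦n⟧) := by
  have hG : ∀ (X : C) (n : ℤ), Nonempty (G.functor.obj (X⟦n⟧) ≅ (G.functor.obj X)⟦n⟧) :=
    fun X n => ⟨(G.functor.commShiftIso n).app X⟩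
  match i with
  | Int.ofNat m => exact nonempty_natPow_shift_iso hG m X n
  | Int.negSucc m =>
    refine nonempty_natPow_shift_iso (fun X n => ?_) (m + 1) X n
    obtain ⟨e⟩ := hG (G.inverse.obj X) n
    exact ⟨G.inverse.mapIso ((shiftFunctor C n).mapIso (G.counitIso.app X).symm ≪≫ e.symm) ≪≫
      (G.unitIso.app _).symm⟩

end Shift

end ZPow

/-! ### Orbits of indecomposable objects -/

section Orbits

variable {H : Type u} [Ring H] [IsNoetherianRing H]
  [HasDerivedCategory.{w} (FGModuleCat.{u} H)]

/-- The degree in which a non-zero shifted module is concentrated is an isomorphism invariant. -/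
lemma eq_of_stalk_shift_iso (hH : IsHereditaryRing H) {X : Db.{w} H} (hX : ¬ IsZero X)
    {U V : FGModuleCat.{u} H} {a b : ℤ} (e : X ≅ (stalk.obj U)⟦a⟧) (e' : X ≅ (stalk.obj V)⟦b⟧) :
    a = b := by
  by_contra hab
  apply hX
  rw [IsZero.iff_id_eq_zero]
  rcases lt_or_gt_of_ne hab with h | h
  · have h1 := stalk_hom_eq_zero hH (Or.inl h) (e'.inv ≫ e.hom)
    have h2 : 𝟙 X = e'.hom ≫ (e'.inv ≫ e.hom) ≫ e.inv := by simp
    rw [h2, h1, zero_comp, comp_zero]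
  · have h1 := stalk_hom_eq_zero hH (Or.inl h) (e.inv ≫ e'.hom)
    have h2 : 𝟙 X = e.hom ≫ (e.inv ≫ e'.hom) ≫ e'.inv := by simp
    rw [h2, h1, zero_comp, comp_zero]

/-- The powers of `G` permute the shifted indecomposable modules, because indecomposability of
objects of `Dᵇ(H)` can be read off from the endomorphism ring. -/
lemma IsShiftedIndecomposable.zPow (k : Type t) [Field k] [Algebra k H]
    [FiniteDimensional k H] (hH : IsHereditaryRing H) (G : Db.{w} H ≌ Db.{w} H)
    [G.functor.Additive] {X : Db.{w} H} (hX : IsShiftedIndecomposable X) (i : ℤ) :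
    IsShiftedIndecomposable ((zPow G i).obj X) := by
  have : IsArtinianRing H := IsArtinianRing.of_finite k H
  have := ((hX.hasNilpotentLocalEnd k).map (OrbitCat.zPow G i)).isLocalRing
  exact .of_indecomposable hH indecomposable_of_isLocalRing_end

variable (G : Db.{w} H ≌ Db.{w} H) [G.functor.CommShift ℤ] [G.functor.Additive]

/-- Condition (g2) forces `G` to act freely on the isomorphism classes of indecomposable objects:
if the orbit of `X` were finite, its members would be modules in boundedly many degrees, and the
orbit of `X[M]` would avoid the degrees in `[-N, N]` for large `M`. -/
lemma not_nonempty_zPow_iso (k : Type t) [Field k] [Algebra k H]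
    [FiniteDimensional k H] (hH : IsHereditaryRing H) (hG2 : ConditionG2 G) {X : Db.{w} H}
    (hX : IsShiftedIndecomposable X) {i : ℤ} (hi : i ≠ 0) :
    ¬ Nonempty ((zPow G i).obj X ≅ X) := by
  rintro ⟨e⟩
  obtain ⟨N, hN⟩ := hG2
  have hV : ∀ j, ∃ (V : FGModuleCat.{u} H) (m : ℤ),
      Nonempty ((zPow G j).obj X ≅ (stalk.obj V)⟦m⟧) := fun j => by
    obtain ⟨V, m, -, h⟩ := hX.zPow k hH G j
    exact ⟨V, m, h⟩
  choose V m hVm using hV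
  -- `-B` bounds from below the shifts that occur in one period
  let B : ℤ := ∑ r ∈ Finset.range i.natAbs, |m r|
  let M : ℤ := N + B + 1
  obtain ⟨j, W, n, -, hn, ⟨eW⟩⟩ := hN (X⟦M⟧) ((hX.shift M).indecomposable k)
  -- reduce `j` modulo the period `i`
  obtain ⟨r, hr, ⟨er⟩⟩ : ∃ r ∈ Finset.range i.natAbs,
      Nonempty ((zPow G j).obj X ≅ (zPow G (r : ℤ)).obj X) := by
    obtain ⟨r, hr⟩ := Int.eq_ofNat_of_zero_le (Int.emod_nonneg j hi)
    refine ⟨r, ?_, ?_⟩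
    · have h := Int.emod_lt_abs j hi
      rw [hr, Int.abs_eq_natAbs] at h
      exact Finset.mem_range.2 (Int.ofNat_lt.1 h)
    · obtain ⟨e'⟩ := nonempty_zPow_mul_iso e (j / i)
      rw [← hr]
      exact ⟨((zPowAdd G (i * (j / i)) (j % i) j (Int.mul_ediv_add_emod j i)).app X).symm ≪≫
        (zPow G _).mapIso e'⟩
  obtain ⟨eV⟩ := hVm r
  obtain ⟨es⟩ := nonempty_zPow_shift_iso (G := G) j X M
  have h1 : (zPow G j).obj (X⟦M⟧) ≅ (stalk.obj (V r))⟦m r + M⟧ :=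
    es ≪≫ (shiftFunctor _ M).mapIso (er ≪≫ eV) ≪≫ ((shiftFunctorAdd _ (m r) M).app _).symm
  have h2 := eq_of_stalk_shift_iso hH
    (((hX.shift M).zPow k hH G j).indecomposable k).1 h1 eW
  have h3 : |m r| ≤ B :=
    Finset.single_le_sum (f := fun r : ℕ => |m r|) (fun _ _ => abs_nonneg _) hr
  have h4 := neg_abs_le (m r)
  have h5 := hn.2
  lia

/-- By (g1) the orbit of `X` meets the modules shifted by a fixed `m` in finitely many isomorphism
classes, and since `G` acts freely each of them occurs for one exponent only. -/
lemma finite_setOf_zPow_iso_stalk_shift (k : Type t) [Field k] [Algebra k H]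
    [FiniteDimensional k H] (hH : IsHereditaryRing H) (hG1 : ConditionG1 G)
    (hG2 : ConditionG2 G) {X : Db.{w} H} (hX : IsShiftedIndecomposable X) (m : ℤ) :
    {i : ℤ | ∃ V : FGModuleCat.{u} H, Indecomposable V ∧
      Nonempty ((zPow G i).obj X ≅ (stalk.obj V)⟦m⟧)}.Finite := by
  set T := {i : ℤ | ∃ V : FGModuleCat.{u} H, Indecomposable V ∧
      Nonempty ((zPow G i).obj X ≅ (stalk.obj V)⟦m⟧)} with hT
  rcases T.eq_empty_or_nonempty with h | ⟨i₀, V₀, hV₀, ⟨e₀⟩⟩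
  · rw [h]
    exact Set.finite_empty
  obtain ⟨S, hS, hSV⟩ := hG1 V₀ hV₀
  have hW : ∀ i ∈ T, ∃ W ∈ S, Nonempty ((zPow G i).obj X ≅ (stalk.obj W)⟦m⟧) := by
    rintro i ⟨V, hV, ⟨e⟩⟩
    obtain ⟨es⟩ := nonempty_zPow_shift_iso (G := G) (i - i₀) (stalk.obj V₀) m
    let a : ((zPow G (i - i₀)).obj (stalk.obj V₀))⟦m⟧ ≅ (stalk.obj V : Db.{w} H)⟦m⟧ :=
      es.symm ≪≫ (zPow G (i - i₀)).mapIso e₀.symm ≪≫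
        (zPowAdd G i₀ (i - i₀) i (by lia)).app X ≪≫ e
    obtain ⟨W, hWS, ⟨b⟩⟩ := hSV (i - i₀) V hV ⟨(shiftFunctor (Db.{w} H) m).preimageIso a⟩
    exact ⟨W, hWS, ⟨e ≪≫ (shiftFunctor _ m).mapIso (stalk.mapIso b)⟩⟩
  choose! W hWS hWX using hW
  refine Set.Finite.of_injOn (f := W) (t := S) hWS (fun i hi j hj hij => ?_) hS
  obtain ⟨a⟩ := hWX i hi
  obtain ⟨b⟩ := hWX j hj
  rw [hij] at a
  obtain ⟨c⟩ := nonempty_zPow_sub_iso (a ≪≫ b.symm)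
  by_contra hne
  exact not_nonempty_zPow_iso G k hH hG2 hX (sub_ne_zero.2 hne) ⟨c⟩

/-- Only finitely many components of the endomorphism ring of an indecomposable object in the
orbit category are non-zero. -/
lemma finite_setOf_hom_ne_zero (k : Type t) [Field k] [Algebra k H]
    [FiniteDimensional k H] (hH : IsHereditaryRing H) (hG1 : ConditionG1 G)
    (hG2 : ConditionG2 G) {X : Db.{w} H} (hX : IsShiftedIndecomposable X) :
    {i : ℤ | ∃ f : (zPow G i).obj X ⟶ X, f ≠ 0}.Finite := by
  obtain ⟨U, n, -, ⟨e⟩⟩ := id hX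
  refine ((finite_setOf_zPow_iso_stalk_shift G k hH hG1 hG2 hX n).union
    (finite_setOf_zPow_iso_stalk_shift G k hH hG1 hG2 hX (n - 1))).subset ?_
  rintro i ⟨f, hf⟩
  obtain ⟨V, m, hV, ⟨e'⟩⟩ := hX.zPow k hH G i
  have hm : m = n ∨ m = n - 1 := by
    by_contra hm
    apply hf
    have h1 := stalk_hom_eq_zero hH (by lia) (e'.inv ≫ f ≫ e.hom)
    rw [← cancel_epi e'.inv, ← cancel_mono e.hom]
    simpa using h1
  rcases hm with rfl | rfl
  · exact Or.inl ⟨V, hV, ⟨e'⟩⟩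
  · exact Or.inr ⟨V, hV, ⟨e'⟩⟩

end Orbits

/-! ### Endomorphism rings in the orbit category -/

section OrbitEnd

variable {C : Type*} [Category C] [Preadditive C] (G : C ≌ C) [G.functor.Additive]

/-- The endomorphisms of degree `i` of an object of the orbit category. -/
def degreePart (X : OrbitCategory G) (i : ℤ) : AddSubgroup (End X) :=
  AddMonoidHom.range (G := (zPow G i).obj X.rep ⟶ X.rep) (N := End X)
    (DirectSum.of (fun i => ((zPow G i).obj X.rep ⟶ X.rep)) i)

variable {G}

lemma iSup_degreePart (X : OrbitCategory G) : ⨆ i, degreePart G X i = ⊤ := by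
  rw [eq_top_iff]
  rintro x -
  refine DirectSum.induction_on (motive := fun x => x ∈ ⨆ i, degreePart G X i) x
    (zero_mem _) (fun i f => ?_) (fun _ _ => add_mem)
  exact le_iSup (degreePart G X) i ⟨f, rfl⟩

lemma mul_mem_degreePart {X : OrbitCategory G} (i j : ℤ) (x y : End X)
    (hx : x ∈ degreePart G X i) (hy : y ∈ degreePart G X j) : x * y ∈ degreePart G X (i + j) := by
  obtain ⟨f, rfl⟩ := hx
  obtain ⟨g, rfl⟩ := hy
  exact ⟨_, (ofDeg_comp G X X X j i (i + j) (add_comm j i) g f).symm⟩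

/-- The endomorphisms of degree `0` of `X` in the orbit category are the endomorphisms of `X`. -/
lemma mem_degreePart_zero {X : C} {x : End ((proj G).obj X)} :
    x ∈ degreePart G ((proj G).obj X) 0 ↔ ∃ f : End X, (proj G).mapEnd X f = x := by
  constructor
  · rintro ⟨f, rfl⟩
    refine ⟨(zPowZero G).inv.app X ≫ f, ?_⟩
    exact congrArg (ofDeg G ((proj G).obj X) ((proj G).obj X) 0)
      ((zPowZero G).hom_inv_id_app_assoc X f)
  · rintro ⟨f, rfl⟩
    exact ⟨_, rfl⟩

/-- The endomorphism ring of `X` in the orbit category is local if the endomorphism ring of `X`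
is local with nilpotent maximal ideal, `X` is not isomorphic to any `Gⁱ X` with `i ≠ 0`, and only
finitely many of the groups `Hom (Gⁱ X, X)` are non-zero. -/
theorem isLocalRing_end_proj {X : C} (hX : HasNilpotentLocalEnd X)
    (hfree : ∀ i ≠ 0, ¬ Nonempty ((zPow G i).obj X ≅ X))
    (hfin : {i : ℤ | ∃ f : (zPow G i).obj X ⟶ X, f ≠ 0}.Finite) :
    IsLocalRing (End ((proj G).obj X)) := by
  obtain ⟨L, hL⟩ := hX.exists_pow
  have hloc := hX.isLocalRing
  have hnil : ∀ f ∈ nonunits (End X), IsNilpotent f := fun f hf =>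
    ⟨L, hL (Set.pow_mem_pow hf)⟩
  have hXz : ¬ IsZero X := not_isZero_of_isLocalRing_end
  have : Nontrivial (End ((proj G).obj X)) := by
    refine ⟨1, 0, fun h => hXz ?_⟩
    have h1 : (zPowZero G).hom.app X = 0 :=
      DirectSum.of_injective (β := fun i => ((zPow G i).obj X ⟶ X)) 0
        (h.trans (map_zero (DirectSum.of (fun i => ((zPow G i).obj X ⟶ X)) 0)).symm)
    rw [IsZero.iff_id_eq_zero]
    exact ((zPowZero G).inv_hom_id_app X).symm.trans
      ((congrArg ((zPowZero G).inv.app X ≫ ·) h1).trans comp_zero)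
  refine isLocalRing_of_grading (A := degreePart G ((proj G).obj X))
    (N := (proj G).mapEnd X '' nonunits (End X)) (L := L) ?_ mul_mem_degreePart ?_ ?_ ?_
    (iSup_degreePart _) ?_ ?_ ?_
  · exact mem_degreePart_zero.2 ⟨1, map_one _⟩
  · rintro _ ⟨f, -, rfl⟩
    exact mem_degreePart_zero.2 ⟨f, rfl⟩
  · rintro _ ⟨f, hf, rfl⟩ y hy
    obtain ⟨g, rfl⟩ := mem_degreePart_zero.1 hy
    exact ⟨g * f, not_isUnit_mul_of_isNilpotent (hnil f hf) g, map_mul _ _ _⟩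
  · rintro i hi _ ⟨(f : (zPow G i).obj X ⟶ X), rfl⟩ _ ⟨(g : (zPow G (-i)).obj X ⟶ X), rfl⟩
    -- the product is `s ≫ f`, so if it were invertible, `X` would be a retract of `Gⁱ X`
    let s : X ⟶ (zPow G i).obj X :=
      (zPowZero G).inv.app X ≫ (zPowAdd G (-i) i 0 (by lia)).inv.app X ≫ (zPow G i).map g
    refine ⟨s ≫ f, fun hu => hfree i hi ?_, ?_⟩
    · obtain ⟨u, hu⟩ := hu
      have h1 : ((↑u⁻¹ : End X) ≫ s) ≫ f = 𝟙 X := by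
        rw [Category.assoc, ← hu]
        exact u.mul_inv
      have := (hX.map (zPow G i)).isLocalRing
      obtain ⟨a⟩ := nonempty_iso_of_retract hXz _ _ h1
      exact ⟨a.symm⟩
    · refine Eq.trans ?_ (ofDeg_comp G ⟨X⟩ ⟨X⟩ ⟨X⟩ (-i) i 0 (by lia) g f).symm
      refine congrArg (ofDeg G ((proj G).obj X) ((proj G).obj X) 0) ?_
      rw [degComp, Category.assoc, Category.assoc]
      exact (zPowZero G).hom_inv_id_app_assoc X _
  · refine hfin.subset fun i hi => ?_
    by_contra hcon
    refine hi ((AddSubgroup.eq_bot_iff_forall _).2 ?_)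
    rintro _ ⟨f, rfl⟩
    have hf : f = 0 := by
      by_contra hf
      exact hcon ⟨f, hf⟩
    rw [hf]
    exact map_zero _
  · rw [← Set.image_pow]
    rintro _ ⟨f, hf, rfl⟩
    have h0 : f = 0 := hL hf
    rw [h0]
    exact (proj G).map_zero X X
  · rintro x hx
    obtain ⟨f, rfl⟩ := mem_degreePart_zero.1 hx
    by_cases hf : IsUnit f
    · right
      obtain ⟨u, rfl⟩ := hf
      refine ⟨(proj G).mapEnd X ↑u⁻¹, mem_degreePart_zero.2 ⟨_, rfl⟩, ?_, ?_⟩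
      · rw [← map_mul, Units.mul_inv, map_one]
      · rw [← map_mul, Units.inv_mul, map_one]
    · exact Or.inl ⟨f, hf, rfl⟩

end OrbitEnd

end OrbitCat

/-- `H` is a finite-dimensional hereditary algebra over a field `k` (the instance
`IsNoetherianRing H` is a consequence of finite-dimensionality, recorded because it gives access
to the abelian structure on finitely generated modules), and `G` is an autoequivalence of `Dᵇ(H)`
which is a triangle functor and satisfies (g1) and (g2). -/
theorem proposition1p2 {k : Type t} [Field k] {H : Type u} [Ring H] [Algebra k H]
    [FiniteDimensional k H] [IsNoetherianRing H] (hH : IsHereditaryRing H)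
    [HasDerivedCategory.{w} (FGModuleCat.{u} H)]
    (G : Db.{w} H ≌ Db.{w} H) [G.functor.CommShift ℤ] [G.functor.IsTriangulated]
    (hG1 : ConditionG1 G) (hG2 : ConditionG2 G) :
    IsKrullSchmidt (OrbitCategory G) ∧
      ∀ X : Db.{w} H, Indecomposable X →
        Indecomposable ((proj G).obj X) ∧ IsLocalRing (End ((proj G).obj X)) := by
  have : IsArtinianRing H := IsArtinianRing.of_finite k H
  have hlocal : ∀ X : Db.{w} H, IsShiftedIndecomposable X →
      IsLocalRing (End ((proj G).obj X)) := fun X hX =>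
    isLocalRing_end_proj (hX.hasNilpotentLocalEnd k)
      (fun i hi => not_nonempty_zPow_iso G k hH hG2 hX hi)
      (finite_setOf_hom_ne_zero G k hH hG1 hG2 hX)
  refine ⟨⟨inferInstance, fun Z => ?_⟩, fun X hX => ?_⟩
  · exact ((sumClosure_isShiftedIndecomposable hH Z.rep).map (proj G)
      (Q := fun Y => IsLocalRing (End Y)) hlocal).exists_fin_bicone
  · have h := hlocal X (.of_indecomposable hH hX)
    exact ⟨indecomposable_of_isLocalRing_end, h⟩
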